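/- Let $d\ge 1$, let $\Omega\subseteq\mathbb{R}^d$ be a nonempty connected open set, and let $a,b:\Omega\to\mathbb{R}$ be measurable with $a\in L^\infty(\Omega)$, $b\in L^\infty_{\mathrm{loc}}(\Omega)$, $b_{\min}:=\operatorname{ess\,inf} b>-\infty$. Put $a_{\min}:=\operatorname{ess\,inf}a$, $a_{\max}:=\operatorname{ess\,sup}a$ and assume $a_{\min}<0<a_{\max}$. Let $D(s_0)$ be the closure of $C_0^\infty(\Omega)$ in the norm $\|\psi\|_{s_0}^2=\|\psi\|^2+\|\nabla\psi\|^2+\|(b-b_{\min})^{1/2}\psi\|^2$ (norms of $L^2(\Omega)$, complex-valued functions), and for $\mu\in\mathbb{R}$ let $S_\mu$ be the self-adjoint operator in $L^2(\Omega)$ associated with the form $s_\mu(\varphi,\psi)=(\nabla\varphi,\nabla\psi)+(\varphi,(b+\mu a)\psi)$ on $D(s_0)$, i.e. $S_\mu=-\Delta+b+\mu a$ with Dirichlet boundary conditions. For $\alpha\in\mathbb{R}$ let $A_\alpha$ be the operator in the Hilbert space $D(s_0)\times L^2(\Omega)$ with domain $D(S_0)\times D(s_0)$ given by $A_\alpha\{\psi_1,\psi_2\}=\{\psi_2,-S_0\psi_1-\alpha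 a\psi_2\}$. For an operator $A$ let $\sigma_{\mathrm e}(A)=\sigma(A)\setminus\sigma_{\mathrm d}(A)$, where $\lambda\in\sigma_{\mathrm d}(A)$ iff $\lambda$ is an isolated point of $\sigma(A)$, is an eigenvalue of finite algebraic multiplicity, and the range of $A-\lambda$ is closed. Let $\gamma_\infty(\mu)=\inf\sigma_{\mathrm e}(S_\mu)\in(-\infty,+\infty]$ (with $\inf\varnothing=+\infty$). For $n\ge1$ let $\gamma_n(\mu)$ be the infimum, over the $n$-dimensional subspaces $L$ of $D(s_0)$, of $\sup_{0\ne\psi\in L}s_\mu(\psi,\psi)/\|\psi\|^2$, and let $N_0$ be the number of $n\ge 1$ with $\gamma_n(0)<\min\{0,\gamma_\infty(0)\}$ (the number of negative eigenvalues of $S_0$ below its essential spectrum, counted with multiplicity). Eigenvalues of $A_\alpha$ are counted with their geometric multiplicity. Then, for all sufficiently large $\alpha$, the spectrum of $A_\alpha$ contains at least one negative and at least one positive real number. Moreover: (i) If $\lim_{\mu\to-\infty}\gamma_\infty(\mu)/\mu<a_{\max}$ (respectively $\lim_{\mu\to+\infty}\gamma_\infty(\mu)/\mu>a_{\min}$),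 the limits being taken in $[-\infty,+\infty]$, then there is a strictly increasing sequence of positive numbers $(\alpha_j)_{j\ge1}$ tending to $+\infty$ such that, for every $j\ge1$ and every $\alpha\in[\alpha_j,\alpha_{j+1})$, $A_\alpha$ has at least $j$ negative (respectively positive) eigenvalues. (ii) If $\gamma_\infty(\mu)>0$ for all $\mu\le0$ (respectively for all $\mu\ge0$), then there is a strictly increasing sequence of positive numbers $(\alpha_j)_{j\ge1}$ tending to $+\infty$ such that, for every $j\ge1$ and every $\alpha\in(\alpha_j,\alpha_{j+1}]$, $A_\alpha$ has at least $2j+N_0$ negative (respectively positive) eigenvalues, and for every $\alpha\in(0,\alpha_1]$ it has at least $N_0$ negative (respectively positive) eigenvalues. (iii) If $\gamma_\infty(\mu)<0$ for some $\mu\le0$ (respectively some $\mu\ge0$), then for all sufficiently large $\alpha$ there is at least one negative (respectively positive) real number in $\sigma_{\mathrm e}(A_\alpha)$. (iv) If $\gamma_\infty(0)>0$ and $\gamma_\infty(\mu)<0$ for some $\mu\le0$ (respectively some $\mu\ge0$), then for all sufficiently large $\alpha$ there are at least two distinct negative (respectively positive) real numbers in $\sigma_{\mathrm e}(A_\alpha)$.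 -/

import Mathlib

open MeasureTheory Filter Topology Set
open scoped ENNReal ContDiff InnerProductSpace ComplexConjugate

noncomputable section

namespace DampedWave

/-! ### Spectral notions for unbounded operators -/

section Spectrum

variable {X : Type*} [NormedAddCommGroup X] [InnerProductSpace ℂ X]

/-- `z` belongs to the resolvent set of the unbounded operator `A` if `A - z` is a bijection from
the domain of `A` onto the whole space with a bounded inverse `R`. -/
def resolventSet (A : X →ₗ.[ℂ] X) : Set ℂ :=
  {z | ∃ R : X →L[ℂ] X,
    (∀ y : X, ∃ hy : R y ∈ A.domain, A ⟨R y, hy⟩ - z • R y = y) ∧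
    ∀ x : A.domain, R (A x - z • (x : X)) = x}

/-- The spectrum `σ(A)`. -/
def spec (A : X →ₗ.[ℂ] X) : Set ℂ := (resolventSet A)ᶜ

/-- The space `{x ∈ D(A) | (A - z) x ∈ W}`. -/
def preimageShift (A : X →ₗ.[ℂ] X) (z : ℂ) (W : Submodule ℂ X) : Submodule ℂ X :=
  (W.comap (A.toFun - z • A.domain.subtype)).map A.domain.subtype

/-- The kernel of `A - z`. -/
def eigenspace (A : X →ₗ.[ℂ] X) (z : ℂ) : Submodule ℂ X := preimageShift A z ⊥

/-- The kernel of `(A - z) ^ k`, on its natural domain. -/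
def kerPow (A : X →ₗ.[ℂ] X) (z : ℂ) : ℕ → Submodule ℂ X
  | 0 => ⊥
  | k + 1 => preimageShift A z (kerPow A z k)

/-- The root space `⋃ₖ ker (A - z) ^ k`, whose dimension is the algebraic multiplicity. -/
def rootSpace (A : X →ₗ.[ℂ] X) (z : ℂ) : Submodule ℂ X := ⨆ k, kerPow A z k

/-- The discrete spectrum `σ_d(A)`: isolated points of the spectrum that are eigenvalues of finite
algebraic multiplicity and for which `A - z` has closed range. -/
def discreteSpec (A : X →ₗ.[ℂ] X) : Set ℂ :=
  {z | z ∈ spec A ∧ (∀ᶠ w in 𝓝[≠] z, w ∉ spec A) ∧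
    eigenspace A z ≠ ⊥ ∧ FiniteDimensional ℂ (rootSpace A z) ∧
    IsClosed (Set.range fun x : A.domain => A x - z • (x : X))}

/-- The essential spectrum `σ_e(A) = σ(A) \ σ_d(A)`. -/
def essSpec (A : X →ₗ.[ℂ] X) : Set ℂ := spec A \ discreteSpec A

/-- The (geometric) multiplicity of `z` as an eigenvalue of `A`; it is `0` if `z` is not an
eigenvalue. -/
def multiplicity (A : X →ₗ.[ℂ] X) (z : ℂ) : ℕ∞ :=
  Cardinal.toENat (Module.rank ℂ (eigenspace A z))

/-- The number of eigenvalues of `A` in the set `I` of real numbers, each one counted with its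
multiplicity. -/
def eigenvalueCount (A : X →ₗ.[ℂ] X) (I : Set ℝ) : ℕ∞ :=
  ⨆ (F : Finset ℝ) (_ : (F : Set ℝ) ⊆ I), ∑ r ∈ F, multiplicity A (r : ℂ)

end Spectrum

/-! ### The function spaces -/

/-- `ℝᵈ`. -/
abbrev Space (d : ℕ) : Type := EuclideanSpace ℝ (Fin d)

section Spaces

variable {d : ℕ}

/-- `L²(Ω)`, complex valued. -/
abbrev L2 (Ω : Set (Space d)) : Type := Lp ℂ 2 (volume.restrict Ω)

/-- `L²(Ω)ᵈ`, the space of the gradients. -/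
abbrev L2Vec (Ω : Set (Space d)) : Type :=
  Lp (EuclideanSpace ℂ (Fin d)) 2 (volume.restrict Ω)

/-- `L²(Ω) × L²(Ω)ᵈ × L²(Ω)` with its Hilbert space norm. -/
abbrev Ambient (Ω : Set (Space d)) : Type := WithLp 2 (L2 Ω × WithLp 2 (L2Vec Ω × L2 Ω))

/-- `φ ∈ C₀^∞(Ω)`. -/
def IsTest (Ω : Set (Space d)) (φ : Space d → ℂ) : Prop :=
  ContDiff ℝ ∞ φ ∧ HasCompactSupport φ ∧ tsupport φ ⊆ Ω

/-- The classical gradient. -/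
def grad (φ : Space d → ℂ) (x : Space d) : EuclideanSpace ℂ (Fin d) :=
  WithLp.toLp 2 fun i => fderiv ℝ φ x (EuclideanSpace.single i 1)

/-- The standing assumptions on the coefficients: `a ∈ L^∞(Ω)`, `b ∈ L^∞_loc(Ω)` and `ess inf b > -∞`, for measurable
functions `a`, `b` on `Ω`. -/
structure H1 (Ω : Set (Space d)) (a b : Space d → ℝ) : Prop where
  a_bdd : MemLp a ∞ (volume.restrict Ω)
  b_meas : AEStronglyMeasurable b (volume.restrict Ω)
  b_loc : ∀ K : Set (Space d), IsCompact K → K ⊆ Ω → MemLp b ∞ (volume.restrict K)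
  b_below : ∃ c : ℝ, ∀ᵐ x ∂volume.restrict Ω, c ≤ b x

/-- The damping takes both signs: `ess inf a < 0 < ess sup a`. -/
def H2 (Ω : Set (Space d)) (a : Space d → ℝ) : Prop :=
  essInf a (volume.restrict Ω) < 0 ∧ 0 < essSup a (volume.restrict Ω)

/-- The weight `(b - b_min)^{1/2}`. -/
def weight (Ω : Set (Space d)) (b : Space d → ℝ) (x : Space d) : ℝ :=
  √(b x - essInf b (volume.restrict Ω))

/-- The triples `(φ, ∇φ, (b - b_min)^{1/2} φ)` with `φ ∈ C₀^∞(Ω)`. -/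
def testSpace (Ω : Set (Space d)) (b : Space d → ℝ) : Submodule ℂ (Ambient Ω) where
  carrier := {U | ∃ φ : Space d → ℂ, IsTest Ω φ ∧
    U.fst =ᵐ[volume.restrict Ω] φ ∧
    U.snd.fst =ᵐ[volume.restrict Ω] grad φ ∧
    U.snd.snd =ᵐ[volume.restrict Ω] fun x => (weight Ω b x : ℂ) * φ x}
  zero_mem' := by
    refine ⟨0, ⟨contDiff_const, HasCompactSupport.zero, by simp [tsupport]⟩, ?_, ?_, ?_⟩
    · exact Lp.coeFn_zero _ _ _
    · refine (Lp.coeFn_zero _ _ _).trans (.of_forall fun x => ?_)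
      ext i; simp [grad]
    · refine (Lp.coeFn_zero _ _ _).trans (.of_forall fun x => ?_)
      simp
  add_mem' := by
    rintro U V ⟨φ, ⟨h1, h2, h3⟩, hU1, hU2, hU3⟩ ⟨χ, ⟨k1, k2, k3⟩, hV1, hV2, hV3⟩
    refine ⟨φ + χ, ⟨h1.add k1, h2.add k2, (tsupport_add _ _).trans (union_subset h3 k3)⟩,
      ?_, ?_, ?_⟩
    · filter_upwards [hU1, hV1, Lp.coeFn_add U.fst V.fst] with x e1 e2 e3
      simp only [WithLp.add_fst, e3, Pi.add_apply, e1, e2]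
    · filter_upwards [hU2, hV2, Lp.coeFn_add U.snd.fst V.snd.fst] with x e1 e2 e3
      simp only [WithLp.add_snd, WithLp.add_fst, e3, Pi.add_apply, e1, e2]
      ext i
      have := fderiv_add (h1.differentiable (by simp) x) (k1.differentiable (by simp) x)
      simp [grad, this]
    · filter_upwards [hU3, hV3, Lp.coeFn_add U.snd.snd V.snd.snd] with x e1 e2 e3
      simp only [WithLp.add_snd, e3, Pi.add_apply, e1, e2, mul_add]
  smul_mem' := by
    rintro c U ⟨φ, ⟨h1, h2, h3⟩, hU1, hU2, hU3⟩
    refine ⟨c • φ, ⟨contDiff_const.smul h1, h2.smul_left, (tsupport_smul_subset_right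
      (fun _ => c) φ).trans h3⟩, ?_, ?_, ?_⟩
    · filter_upwards [hU1, Lp.coeFn_smul c U.fst] with x e1 e3
      simp [e3, e1]
    · filter_upwards [hU2, Lp.coeFn_smul c U.snd.fst] with x e1 e3
      simp only [WithLp.smul_snd, WithLp.smul_fst, e3, Pi.smul_apply, e1]
      ext i
      have := fderiv_const_smul (h1.differentiable (by simp) x) c
      simp [grad, this]
    · filter_upwards [hU3, Lp.coeFn_smul c U.snd.snd] with x e1 e3
      simp [e3, e1]; ring

/-- The form domain `D(s₀)`: the completion of `C₀^∞(Ω)` for the norm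
`‖ψ‖² = ‖ψ‖²_{H¹(Ω)} + ‖(b - b_min)^{1/2} ψ‖²`, realized as the closure of the triples
`(φ, ∇φ, (b - b_min)^{1/2} φ)`. It is embedded in `L²(Ω)` by `toL2`. -/
def formDomain (Ω : Set (Space d)) (b : Space d → ℝ) : Submodule ℂ (Ambient Ω) :=
  (testSpace Ω b).topologicalClosure

variable {Ω : Set (Space d)} {a b : Space d → ℝ}

/-- `D(s₀)` as a Hilbert space, with its norm `‖·‖_{s₀}`. -/
def FormDomain (Ω : Set (Space d)) (b : Space d → ℝ) : Type := formDomain Ω b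

instance : NormedAddCommGroup (FormDomain Ω b) :=
  inferInstanceAs (NormedAddCommGroup (formDomain Ω b))

instance : InnerProductSpace ℂ (FormDomain Ω b) :=
  inferInstanceAs (InnerProductSpace ℂ (formDomain Ω b))

instance : CompleteSpace (FormDomain Ω b) :=
  inferInstanceAs (CompleteSpace (testSpace Ω b).topologicalClosure)

/-- The triple `(ψ, ∇ψ, (b - b_min)^{1/2} ψ)` of an element of `D(s₀)`. -/
def FormDomain.amb (u : FormDomain Ω b) : Ambient Ω :=
  Subtype.val (p := fun U => U ∈ formDomain Ω b) u

/-- The embedding of `D(s₀)` in `L²(Ω)`. -/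
def toL2 (u : FormDomain Ω b) : L2 Ω := u.amb.fst

/-- The weak gradient of an element of `D(s₀)`. -/
def weakGrad (u : FormDomain Ω b) : L2Vec Ω := u.amb.snd.fst

/-- The form `s_μ(v, u) = (∇v, ∇u) + (v, (b + μ a) u)`, with domain `D(s₀)`. -/
def form (a : Space d → ℝ) (μ : ℝ) (v u : FormDomain Ω b) : ℂ :=
  ⟪weakGrad v, weakGrad u⟫_ℂ +
    ∫ x in Ω, conj (toL2 v x) * (((b x + μ * a x : ℝ) : ℂ) * toL2 u x)

/-! Facts that make the definitions meaningful. -/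

theorem toL2_add (u v : FormDomain Ω b) : toL2 (u + v) = toL2 u + toL2 v := rfl

theorem toL2_smul (c : ℂ) (u : FormDomain Ω b) : toL2 (c • u) = c • toL2 u := rfl

theorem weight_ae (u : FormDomain Ω b) :
    u.amb.snd.snd =ᵐ[volume.restrict Ω] fun x => (weight Ω b x : ℂ) * toL2 u x := by
  obtain ⟨U, hU⟩ := u
  obtain ⟨s, hs, hlim⟩ := mem_closure_iff_seq_limit.1 hU
  have c1 : Tendsto (fun n => (s n).fst) atTop (𝓝 U.fst) :=
    ((WithLp.continuous_fst 2 _ _).tendsto U).comp hlim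
  have c2 : Tendsto (fun n => (s n).snd.snd) atTop (𝓝 U.snd.snd) :=
    (((WithLp.continuous_snd 2 _ _).comp (WithLp.continuous_snd 2 _ _)).tendsto U).comp hlim
  obtain ⟨n1, hn1, e1⟩ := (tendstoInMeasure_of_tendsto_Lp c1).exists_seq_tendsto_ae
  obtain ⟨n2, hn2, e2⟩ := (tendstoInMeasure_of_tendsto_Lp
    (c2.comp hn1.tendsto_atTop)).exists_seq_tendsto_ae
  have hs' : ∀ᵐ x ∂volume.restrict Ω, ∀ n, (s n).snd.snd x = (weight Ω b x : ℂ) * (s n).fst x := by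
    rw [ae_all_iff]
    intro n
    obtain ⟨φ, -, h1, -, h3⟩ := hs n
    filter_upwards [h1, h3] with x k1 k3
    rw [k1, k3]
  filter_upwards [e1, e2, hs'] with x k1 k2 k3
  refine tendsto_nhds_unique k2 ?_
  simp only [Function.comp_apply, k3]
  exact ((k1.comp hn2.tendsto_atTop).const_mul _)

theorem weight_sq (h : H1 Ω a b) :
    ∀ᵐ x ∂volume.restrict Ω, weight Ω b x ^ 2 = b x - essInf b (volume.restrict Ω) := by
  by_cases h0 : (volume.restrict Ω : Measure (Space d)) = 0
  · rw [h0]; simp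
  obtain ⟨c, hc⟩ := h.b_below
  have hb : ∀ᵐ x ∂volume.restrict Ω, essInf b (volume.restrict Ω) ≤ b x := by
    have : IsBoundedUnder (· ≥ ·) (ae (volume.restrict Ω)) b := ⟨c, by simpa using hc⟩
    exact ae_essInf_le this
  filter_upwards [hb] with x hx
  exact Real.sq_sqrt (sub_nonneg.2 hx)

theorem integrable_conj_mul (f g : L2 Ω) : IntegrableOn (fun x => conj (f x) * g x) Ω := by
  refine (L2.integrable_inner (𝕜 := ℂ) f g).congr (.of_forall fun x => ?_)
  simp [mul_comm]

theorem integrable_form (h : H1 Ω a b) (μ : ℝ) (v u : FormDomain Ω b) :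
    IntegrableOn (fun x => conj (toL2 v x) * (((b x + μ * a x : ℝ) : ℂ) * toL2 u x)) Ω := by
  have i0 := integrable_conj_mul (toL2 v) (toL2 u)
  have i1 := integrable_conj_mul v.amb.snd.snd u.amb.snd.snd
  have ia : IntegrableOn (fun x => (a x : ℂ) * (conj (toL2 v x) * toL2 u x)) Ω :=
    MemLp.integrable_mul (p := ∞) (q := 1) h.a_bdd.ofReal (memLp_one_iff_integrable.2 i0)
  have := (i1.add (i0.const_mul ((essInf b (volume.restrict Ω) : ℝ) : ℂ))).add (ia.const_mul (μ : ℂ))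
  refine this.congr ?_
  filter_upwards [weight_ae u, weight_ae v, weight_sq h] with x e1 e2 e3
  have e4 : (weight Ω b x : ℂ) * weight Ω b x =
      (b x : ℂ) - (essInf b (volume.restrict Ω) : ℝ) := by
    rw [← sq]; exact_mod_cast e3
  simp only [Pi.add_apply, e1, e2, map_mul, Complex.conj_ofReal]
  push_cast
  linear_combination (conj (toL2 v x) * toL2 u x) * e4

theorem form_add (h : H1 Ω a b) (μ : ℝ) (v u w : FormDomain Ω b) :
    form a μ v (u + w) = form a μ v u + form a μ v w := by
  have e : ∫ x in Ω, conj (toL2 v x) * (((b x + μ * a x : ℝ) : ℂ) * toL2 (u + w) x) =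
      ∫ x in Ω, (conj (toL2 v x) * (((b x + μ * a x : ℝ) : ℂ) * toL2 u x) +
        conj (toL2 v x) * (((b x + μ * a x : ℝ) : ℂ) * toL2 w x)) := by
    refine integral_congr_ae ?_
    filter_upwards [Lp.coeFn_add (toL2 u) (toL2 w)] with x hx
    rw [toL2_add, hx, Pi.add_apply]; ring
  have e' : weakGrad (u + w) = weakGrad u + weakGrad w := rfl
  rw [form, e, e', integral_add (integrable_form h μ v u) (integrable_form h μ v w),
    inner_add_right, form, form]
  ring

theorem form_smul (μ : ℝ) (c : ℂ) (v u : FormDomain Ω b) :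
    form a μ v (c • u) = c * form a μ v u := by
  have e : ∫ x in Ω, conj (toL2 v x) * (((b x + μ * a x : ℝ) : ℂ) * toL2 (c • u) x) =
      ∫ x in Ω, c * (conj (toL2 v x) * (((b x + μ * a x : ℝ) : ℂ) * toL2 u x)) := by
    refine integral_congr_ae ?_
    filter_upwards [Lp.coeFn_smul c (toL2 u)] with x hx
    rw [toL2_smul, hx, Pi.smul_apply, smul_eq_mul]; ring
  have e' : weakGrad (c • u) = c • weakGrad u := rfl
  rw [form, e, e', integral_const_mul, inner_smul_right, form]
  ring

/-- A function in `L²(Ω)` is zero if it is orthogonal to all test functions. -/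
theorem eq_zero_of_test (hΩ : IsOpen Ω) {f : Space d → ℂ} (hf : MemLp f 2 (volume.restrict Ω))
    (h : ∀ g : Space d → ℝ, ContDiff ℝ ∞ g → HasCompactSupport g → tsupport g ⊆ Ω →
      ∫ x in Ω, (g x : ℂ) * f x = 0) : f =ᵐ[volume.restrict Ω] 0 := by
  have hl : LocallyIntegrableOn f Ω volume :=
    locallyIntegrableOn_of_locallyIntegrable_restrict (hf.locallyIntegrable (by norm_num))
  have := hΩ.ae_eq_zero_of_integral_contDiff_smul_eq_zero hl (fun g h1 h2 h3 => ?_)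
  · exact (ae_restrict_iff' hΩ.measurableSet).2 this
  · rw [← h g h1 h2 h3, ← integral_indicator hΩ.measurableSet]
    refine integral_congr_ae (.of_forall fun x => ?_)
    by_cases hx : x ∈ Ω
    · simp [hx]
    · have : g x = 0 := image_eq_zero_of_notMem_tsupport fun hx' => hx (h3 hx')
      simp [hx, this]

theorem isTest_ofReal {g : Space d → ℝ} (h1 : ContDiff ℝ ∞ g) (h2 : HasCompactSupport g)
    (h3 : tsupport g ⊆ Ω) : IsTest Ω fun x => (g x : ℂ) :=
  ⟨Complex.ofRealCLM.contDiff.comp h1, h2.comp_left (g := fun r : ℝ => (r : ℂ)) (by simp),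
    (tsupport_comp_subset (g := fun r : ℝ => (r : ℂ)) (by simp) g).trans h3⟩

/-- The form domain contains all the test functions. -/
theorem exists_test (h : H1 Ω a b) {φ : Space d → ℂ} (hφ : IsTest Ω φ) :
    ∃ v : FormDomain Ω b, toL2 v =ᵐ[volume.restrict Ω] φ := by
  obtain ⟨h1, h2, h3⟩ := hφ
  have m1 : MemLp φ 2 (volume.restrict Ω) := (h1.continuous.memLp_of_hasCompactSupport h2)
  have m2 : MemLp (grad φ) 2 (volume.restrict Ω) := by
    have hc : Continuous (grad φ) := by
      refine (PiLp.continuous_toLp 2 _).comp (continuous_pi fun i => ?_)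
      exact (h1.continuous_fderiv (by simp)).clm_apply continuous_const
    refine hc.memLp_of_hasCompactSupport ?_
    refine (h2.fderiv (𝕜 := ℝ)).mono fun x hx => ?_
    contrapose! hx
    simp only [Function.mem_support, not_not] at hx ⊢
    ext i; simp [grad, hx]
  have m3 : MemLp (fun x => (weight Ω b x : ℂ) * φ x) 2 (volume.restrict Ω) := by
    have hw : AEStronglyMeasurable (weight Ω b) (volume.restrict Ω) :=
      Real.continuous_sqrt.comp_aestronglyMeasurable
        (h.b_meas.sub aestronglyMeasurable_const)
    obtain ⟨M, hM⟩ : ∃ M : ℝ, ∀ᵐ x ∂volume.restrict (tsupport φ), ‖b x‖ ≤ M := by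
      have hb := (h.b_loc _ h2 h3).eLpNorm_lt_top
      rw [eLpNorm_exponent_top] at hb
      obtain ⟨M, hM⟩ := eLpNormEssSup_lt_top_iff_isBoundedUnder.1 hb
      exact ⟨M, by simpa [← NNReal.coe_le_coe] using hM⟩
    refine m1.of_le_mul (c := √(M - essInf b (volume.restrict Ω)))
      ((Complex.continuous_ofReal.comp_aestronglyMeasurable hw).mul m1.1) ?_
    filter_upwards [ae_restrict_of_ae
      ((ae_restrict_iff' (isClosed_tsupport φ).measurableSet).1 hM)] with x hx
    by_cases hx' : x ∈ tsupport φ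
    · rw [norm_mul]
      gcongr
      rw [Complex.norm_real, weight, Real.norm_of_nonneg (Real.sqrt_nonneg _)]
      gcongr
      exact (le_abs_self _).trans (hx hx')
    · simp [image_eq_zero_of_notMem_tsupport hx']
  exact ⟨⟨WithLp.toLp 2 (m1.toLp, WithLp.toLp 2 (m2.toLp, m3.toLp)),
    Submodule.le_topologicalClosure _ ⟨φ, ⟨h1, h2, h3⟩, m1.coeFn_toLp, m2.coeFn_toLp,
      m3.coeFn_toLp⟩⟩, m1.coeFn_toLp⟩

/-- `weakGrad` is the gradient in the sense of distributions. -/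
theorem integral_test_mul_weakGrad {g : Space d → ℝ} (h1 : ContDiff ℝ ∞ g)
    (h2 : HasCompactSupport g) (u : FormDomain Ω b) (i : Fin d) :
    ∫ x in Ω, (g x : ℂ) * weakGrad u x i =
      -∫ x in Ω, ((fderiv ℝ g x (EuclideanSpace.single i 1) : ℝ) : ℂ) * toL2 u x := by
  have hG : MemLp (fun x => EuclideanSpace.single i (g x : ℂ)) 2 (volume.restrict Ω) := by
    have hc : Continuous fun x => EuclideanSpace.single i (g x : ℂ) := by
      refine (PiLp.continuous_toLp 2 _).comp ((continuous_single i).comp ?_)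
      exact Complex.continuous_ofReal.comp h1.continuous
    refine hc.memLp_of_hasCompactSupport (h2.mono fun x hx => ?_)
    contrapose! hx
    simp only [Function.mem_support, not_not] at hx ⊢
    simp [hx]
  have hD : MemLp (fun x => ((fderiv ℝ g x (EuclideanSpace.single i 1) : ℝ) : ℂ)) 2
      (volume.restrict Ω) := by
    have hc : Continuous fun x => ((fderiv ℝ g x (EuclideanSpace.single i 1) : ℝ) : ℂ) :=
      Complex.continuous_ofReal.comp
        ((h1.continuous_fderiv (by simp)).clm_apply continuous_const)
    refine hc.memLp_of_hasCompactSupport ((h2.fderiv (𝕜 := ℝ)).mono fun x hx => ?_)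
    contrapose! hx
    simp only [Function.mem_support, not_not] at hx ⊢
    simp [hx]
  have eG : ∀ U : Ambient Ω, ⟪hG.toLp, U.snd.fst⟫_ℂ = ∫ x in Ω, (g x : ℂ) * U.snd.fst x i := by
    intro U
    rw [L2.inner_def]
    refine integral_congr_ae ?_
    filter_upwards [hG.coeFn_toLp] with x hx
    rw [hx, EuclideanSpace.inner_single_left]
    simp
  have eD : ∀ U : Ambient Ω, ⟪hD.toLp, U.fst⟫_ℂ =
      ∫ x in Ω, ((fderiv ℝ g x (EuclideanSpace.single i 1) : ℝ) : ℂ) * U.fst x := by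
    intro U
    rw [L2.inner_def]
    refine integral_congr_ae ?_
    filter_upwards [hD.coeFn_toLp] with x hx
    rw [hx]
    simp [mul_comm]
  have hcl : IsClosed {U : Ambient Ω | ⟪hG.toLp, U.snd.fst⟫_ℂ = -⟪hD.toLp, U.fst⟫_ℂ} := by
    refine isClosed_eq ?_ ?_
    · exact continuous_const.inner
        ((WithLp.continuous_fst 2 _ _).comp (WithLp.continuous_snd 2 _ _))
    · exact (continuous_const.inner (WithLp.continuous_fst 2 _ _)).neg
  have hsub : (testSpace Ω b : Set (Ambient Ω)) ⊆
      {U : Ambient Ω | ⟪hG.toLp, U.snd.fst⟫_ℂ = -⟪hD.toLp, U.fst⟫_ℂ} := by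
    rintro U ⟨φ, ⟨k1, k2, k3⟩, e1, e2, -⟩
    rw [mem_ofPred_eq, eG, eD]
    have a1 : ∫ x in Ω, (g x : ℂ) * U.snd.fst x i =
        ∫ x, (g x : ℂ) * fderiv ℝ φ x (EuclideanSpace.single i 1) := by
      rw [← setIntegral_eq_integral_of_forall_compl_eq_zero (s := Ω)
        (f := fun x => (g x : ℂ) * fderiv ℝ φ x (EuclideanSpace.single i 1))]
      · refine integral_congr_ae ?_
        filter_upwards [e2] with x hx
        rw [hx]; simp [grad]
      · intro x hx
        have : fderiv ℝ φ x = 0 := image_eq_zero_of_notMem_tsupport fun hx' =>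
          hx (k3 (tsupport_fderiv_subset ℝ hx'))
        simp [this]
    have a2 : ∫ x in Ω, ((fderiv ℝ g x (EuclideanSpace.single i 1) : ℝ) : ℂ) * U.fst x =
        ∫ x, fderiv ℝ (fun y => (g y : ℂ)) x (EuclideanSpace.single i 1) * φ x := by
      rw [← setIntegral_eq_integral_of_forall_compl_eq_zero (s := Ω)
        (f := fun x => fderiv ℝ (fun y => (g y : ℂ)) x (EuclideanSpace.single i 1) * φ x)]
      · refine integral_congr_ae ?_
        filter_upwards [e1] with x hx
        have hd : HasFDerivAt (fun y => (g y : ℂ)) (Complex.ofRealCLM ∘L fderiv ℝ g x) x :=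
          Complex.ofRealCLM.hasFDerivAt.comp x (h1.differentiable (by simp) x).hasFDerivAt
        rw [hx, hd.fderiv]; simp
      · intro x hx
        have : φ x = 0 := image_eq_zero_of_notMem_tsupport fun hx' => hx (k3 hx')
        simp [this]
    rw [a1, a2]
    have gs : ContDiff ℝ ∞ fun y => (g y : ℂ) := Complex.ofRealCLM.contDiff.comp h1
    have cd1 : Continuous fun x => fderiv ℝ φ x (EuclideanSpace.single i 1) :=
      (k1.continuous_fderiv (by simp)).clm_apply continuous_const
    have cd2 : Continuous fun x =>
        fderiv ℝ (fun y => (g y : ℂ)) x (EuclideanSpace.single i 1) :=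
      (gs.continuous_fderiv (by simp)).clm_apply continuous_const
    have h2' : HasCompactSupport fun y => (g y : ℂ) :=
      h2.comp_left (g := fun r : ℝ => (r : ℂ)) (by simp)
    exact integral_mul_fderiv_eq_neg_fderiv_mul_of_integrable
      ((cd2.mul k1.continuous).integrable_of_hasCompactSupport k2.mul_left)
      ((gs.continuous.mul cd1).integrable_of_hasCompactSupport h2'.mul_right)
      ((gs.continuous.mul k1.continuous).integrable_of_hasCompactSupport k2.mul_left)
      (fun x _ => gs.differentiable (by simp) x) (fun x _ => k1.differentiable (by simp) x)
  have := closure_minimal hsub hcl u.2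
  rw [mem_ofPred_eq, eG, eD] at this
  exact this

/-- The embedding of the form domain in `L²(Ω)` is injective. -/
theorem eq_zero_of_toL2 (hΩ : IsOpen Ω) {u : FormDomain Ω b} (hu : toL2 u = 0) : u = 0 := by
  have hw : u.amb.snd.snd = 0 := by
    refine (Lp.eq_zero_iff_ae_eq_zero).2 ?_
    filter_upwards [weight_ae u, Lp.coeFn_zero ℂ 2 (volume.restrict Ω)] with x h1 h2
    rw [h1, hu, h2]; simp
  have hg : weakGrad u = 0 := by
    refine (Lp.eq_zero_iff_ae_eq_zero).2 ?_
    have hi : ∀ i, (fun x => weakGrad u x i) =ᵐ[volume.restrict Ω] 0 := fun i => by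
      have hm : MemLp (fun x => weakGrad u x i) 2 (volume.restrict Ω) :=
        (EuclideanSpace.proj i : EuclideanSpace ℂ (Fin d) →L[ℂ] ℂ).comp_memLp' (Lp.memLp _)
      refine eq_zero_of_test hΩ hm fun g h1 h2 h3 => ?_
      rw [integral_test_mul_weakGrad h1 h2 u i, hu]
      have : (fun x => ((fderiv ℝ g x (EuclideanSpace.single i 1) : ℝ) : ℂ) * (0 : L2 Ω) x)
          =ᵐ[volume.restrict Ω] fun _ => 0 := by
        filter_upwards [Lp.coeFn_zero ℂ 2 (volume.restrict Ω)] with x hx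
        rw [hx]; simp
      rw [integral_congr_ae this]; simp
    filter_upwards [ae_all_iff.2 hi] with x hx
    ext i
    exact hx i
  exact Subtype.ext (WithLp.ofLp_injective 2 (Prod.ext hu (WithLp.ofLp_injective 2
    (Prod.ext hg hw))))

variable (h : H1 Ω a b) (μ : ℝ)

/-- The graph of `S_μ`, in the sense of the representation theorem: `S_μ ψ = f` if `ψ ∈ D(s₀)`
and `s_μ(v, ψ) = (v, f)` for all `v ∈ D(s₀)`. -/
def schrodingerGraph : Submodule ℂ (L2 Ω × L2 Ω) where
  carrier := {p | ∃ u : FormDomain Ω b, toL2 u = p.1 ∧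
    ∀ v : FormDomain Ω b, form a μ v u = ⟪toL2 v, p.2⟫_ℂ}
  zero_mem' := ⟨0, rfl, fun v => by
    have := form_smul (a := a) μ 0 v 0
    simpa using this⟩
  add_mem' := by
    rintro p q ⟨u, hu, hu'⟩ ⟨w, hw, hw'⟩
    exact ⟨u + w, by rw [toL2_add, hu, hw]; rfl, fun v => by
      rw [form_add h, hu', hw', Prod.snd_add, inner_add_right]⟩
  smul_mem' := by
    rintro c p ⟨u, hu, hu'⟩
    exact ⟨c • u, by rw [toL2_smul, hu]; rfl, fun v => by
      rw [form_smul, hu', Prod.smul_snd, inner_smul_right]⟩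

/-- The Schrödinger operator `S_μ = -Δ + b + μ a` in `L²(Ω)`, with Dirichlet boundary
conditions: the operator associated with the form `s_μ`. -/
def schrodinger : L2 Ω →ₗ.[ℂ] L2 Ω := (schrodingerGraph h μ).toLinearPMap

theorem schrodinger_graph (hΩ : IsOpen Ω) : (schrodinger h μ).graph = schrodingerGraph h μ := by
  refine Submodule.toLinearPMap_graph_eq _ ?_
  rintro ⟨f, g⟩ ⟨u, hu, hu'⟩ (rfl : f = 0)
  obtain rfl := eq_zero_of_toL2 hΩ hu
  have key : ∀ v : FormDomain Ω b, ⟪toL2 v, g⟫_ℂ = 0 := fun v => by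
    have := form_smul (a := a) μ 0 v 0
    rw [← hu' v]; simpa using this
  refine (Lp.eq_zero_iff_ae_eq_zero).2 (eq_zero_of_test hΩ (Lp.memLp g) fun k h1 h2 h3 => ?_)
  obtain ⟨v, hv⟩ := exists_test h (isTest_ofReal h1 h2 h3)
  rw [← key v, L2.inner_def]
  refine integral_congr_ae ?_
  filter_upwards [hv] with x hx
  simp [hx, mul_comm]

/-- The Hilbert space `𝓗 = D(s₀) × L²(Ω)`. -/
abbrev Energy (Ω : Set (Space d)) (b : Space d → ℝ) : Type := WithLp 2 (FormDomain Ω b × L2 Ω)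

variable (α : ℝ)

/-- The graph of `A_α`: the pairs `(Ψ, Φ)` with `Ψ ∈ D(S₀) × D(s₀)`, `Φ₁ = Ψ₂` and
`Φ₂ = -S₀ Ψ₁ - α a Ψ₂`. -/
def waveGraph : Submodule ℂ (Energy Ω b × Energy Ω b) where
  carrier := {p | toL2 p.2.fst = p.1.snd ∧
    ∃ f : L2 Ω, (toL2 p.1.fst, f) ∈ (schrodinger h 0).graph ∧
      p.2.snd =ᵐ[volume.restrict Ω] fun x => -f x - ((α * a x : ℝ) : ℂ) * p.1.snd x}
  zero_mem' := by
    refine ⟨rfl, 0, Submodule.zero_mem _, ?_⟩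
    change ((0 : L2 Ω) : Space d → ℂ) =ᵐ[_] fun x => -(0 : L2 Ω) x - _ * (0 : L2 Ω) x
    filter_upwards [Lp.coeFn_zero ℂ 2 (volume.restrict Ω)] with x hx
    rw [hx]; simp
  add_mem' := by
    rintro p q ⟨hp, f, hf, hf'⟩ ⟨hq, g, hg, hg'⟩
    refine ⟨?_, f + g, Submodule.add_mem _ hf hg, ?_⟩
    · change toL2 (p.2.fst + q.2.fst) = p.1.snd + q.1.snd
      rw [toL2_add, hp, hq]
    · change ((p.2.snd + q.2.snd : L2 Ω) : Space d → ℂ) =ᵐ[_]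
        fun x => -(f + g) x - _ * (p.1.snd + q.1.snd : L2 Ω) x
      filter_upwards [hf', hg', Lp.coeFn_add p.2.snd q.2.snd, Lp.coeFn_add f g,
        Lp.coeFn_add p.1.snd q.1.snd] with x e1 e2 e3 e4 e5
      rw [e3, e4, e5, Pi.add_apply, Pi.add_apply, Pi.add_apply, e1, e2]
      ring
  smul_mem' := by
    rintro c p ⟨hp, f, hf, hf'⟩
    refine ⟨?_, c • f, Submodule.smul_mem _ c hf, ?_⟩
    · change toL2 (c • p.2.fst) = c • p.1.snd
      rw [toL2_smul, hp]
    · change ((c • p.2.snd : L2 Ω) : Space d → ℂ) =ᵐ[_]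
        fun x => -(c • f) x - _ * (c • p.1.snd : L2 Ω) x
      filter_upwards [hf', Lp.coeFn_smul c p.2.snd, Lp.coeFn_smul c f,
        Lp.coeFn_smul c p.1.snd] with x e1 e3 e4 e5
      rw [e3, e4, e5, Pi.smul_apply, Pi.smul_apply, Pi.smul_apply, e1]
      simp only [smul_eq_mul]
      ring

/-- The damped wave operator `A_α {ψ₁, ψ₂} = {ψ₂, -S₀ ψ₁ - α a ψ₂}` in `D(s₀) × L²(Ω)`, with
domain `D(S₀) × D(s₀)`. -/
def waveOp : Energy Ω b →ₗ.[ℂ] Energy Ω b := (waveGraph h α).toLinearPMap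

theorem waveOp_graph (hΩ : IsOpen Ω) : (waveOp h α).graph = waveGraph h α := by
  refine Submodule.toLinearPMap_graph_eq _ ?_
  rintro ⟨p, q⟩ ⟨hp, f, hf, hf'⟩ (rfl : p = 0)
  have q1 : q.fst = 0 := eq_zero_of_toL2 hΩ hp
  have f0 : f = 0 := LinearPMap.graph_fst_eq_zero_snd _ hf rfl
  have q2 : q.snd = 0 := by
    refine (Lp.eq_zero_iff_ae_eq_zero).2 (hf'.trans ?_)
    subst f0
    change (fun x => -(0 : L2 Ω) x - _ * (0 : L2 Ω) x) =ᵐ[_] 0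
    filter_upwards [Lp.coeFn_zero ℂ 2 (volume.restrict Ω)] with x hx
    rw [hx]; simp
  exact (WithLp.ofLp_injective 2) (Prod.ext q1 q2)

/-! ### The spectral functions of `S_μ` -/

/-- The Rayleigh-Ritz numbers
`γ_n(μ) = inf {sup_{ψ ∈ L} s_μ[ψ] / ‖ψ‖² | L ⊆ D(s₀), dim L = n}`, for `n ≥ 1`. -/
def rayleigh (Ω : Set (Space d)) (a b : Space d → ℝ) (n : ℕ) (μ : ℝ) : EReal :=
  ⨅ (L : Submodule ℂ (FormDomain Ω b)) (_ : Module.finrank ℂ L = n),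
    ⨆ (u : FormDomain Ω b) (_ : u ∈ L ∧ u ≠ 0),
      (((form a μ u u).re / ‖toL2 u‖ ^ 2 : ℝ) : EReal)

/-- `γ_∞(μ) = inf σ_e(S_μ)`, which is `+∞` if the essential spectrum is empty. -/
def gammaInf (μ : ℝ) : EReal :=
  ⨅ (r : ℝ) (_ : (r : ℂ) ∈ essSpec (schrodinger h μ)), (r : EReal)

/-- `N_μ`, the number of `n ≥ 1` with `γ_n(μ) < min {0, γ_∞(μ)}`. -/
def negCount : ℕ∞ :=
  {n : ℕ | 1 ≤ n ∧ rayleigh Ω a b n μ < min 0 (gammaInf h μ)}.encard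

end Spaces

end DampedWave

end

open DampedWave

/-!
The spectral problem for `A_α` at a real point `t` is a spectral problem for a Schrödinger operator:
eliminating the second component from `(A_α - t) Ψ = {0, -g}` leaves `(S_{α t} + t²) ψ = g`. Hence
`t` is an eigenvalue of `A_α`, or a point of its essential spectrum, as soon as `-t²` is one of
`S_{α t}`. With `μ = α t`, one looks for intersections of the parabola `-(μ / α)²` with the curves
`γ_n(μ)` below `γ_∞(μ)`, where they are eigenvalues of `S_μ`, or with the curve `γ_∞(μ)` itself.
These curves are Lipschitz continuous (as soon as they are finite) and decrease at most linearly,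
so that far away they are above the parabola. On the other hand `γ_n(μ) ≤ c μ` for large `|μ|`,
where `c` is as close as one likes to `ess sup a` for `μ < 0` and to `ess inf a` for `μ > 0`,
because the damping is close to its essential bounds on subspaces of the form domain of any
dimension. For large `α` the parabola is flat, hence any point at which a curve is negative
produces an intersection beyond it, and a second one before it if the curve is positive at `μ = 0`.
Sign changes of `μ` are absorbed in a parameter `σ = ±1`, with `μ = σ τ` and `τ ≥ 0`.

The relation between the min-max numbers `γ_n` and the spectrum of `S_μ` is proved without the
spectral theorem for unbounded operators. The form of `S_μ - c` is represented by a bounded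
self-adjoint operator `T_c` in `D(s₀)`, of the shape `1 + j† (B - c) j`, where `j` is the embedding
in `L²(Ω)` and `B` is the multiplication by `b_min - 1 + μ a` (`formOp`). Call `c` regular if `T_c`
has a finite-dimensional kernel and a closed range; the points outside the essential spectrum are
regular, and so are the points below some `γ_n`, for `T_c` is then coercive on a subspace of finite
codimension (`finiteDimensional_ker_isClosed_range_of_lt_minmax`). At a regular point, the square
roots of the positive and negative parts of `T_c` split `D(s₀)` into the kernel, a positive and a
negative subspace (`exists_definite_splitting`). Counting dimensions, either all the `γ_n` stay below
`c` by a fixed amount, or there is an `m` such that `γ_n` is below `c` by a fixed amount for `n ≤ m`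
and above `c` by a fixed amount for `n > m + dim ker T_c` (`minmax_dichotomy`). So the limit of
the `γ_n` is never regular, it is the infimum of the essential spectrum
(`IsFormOperator.iInf_essSpec`), and below it a number which occurs `k` times among the `γ_n` is an
eigenvalue of multiplicity at least `k` (`card_minmax_eq_le`).
-/

namespace DampedWave

/-! ### Self-adjoint operators with closed range -/

section SelfAdjoint

variable {V : Type*} [NormedAddCommGroup V] [InnerProductSpace ℂ V] [CompleteSpace V]

/-- The open mapping theorem: an operator with closed range is bounded below on the orthogonal
complement of its kernel. -/
theorem exists_norm_le_of_isClosed_range {T : V →L[ℂ] V} (hT : IsClosed (range T)) :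
    ∃ c : ℝ, 0 < c ∧ ∀ u ∈ (LinearMap.ker T.toLinearMap)ᗮ, c * ‖u‖ ≤ ‖T u‖ := by
  set K : Submodule ℂ V := LinearMap.ker T.toLinearMap with hK
  have : CompleteSpace K := (ContinuousLinearMap.isClosed_ker T).completeSpace_coe
  set f : Kᗮ →L[ℂ] V := T ∘L Kᗮ.subtypeL with hf
  have hinj : Function.Injective f := by
    rw [injective_iff_map_eq_zero]
    rintro ⟨u, hu⟩ h
    have h1 : u ∈ K := h
    have := Submodule.inner_right_of_mem_orthogonal h1 hu
    exact Subtype.ext (inner_self_eq_zero.1 this)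
  have hr : range f = range T := by
    refine subset_antisymm (by rintro _ ⟨u, rfl⟩; exact ⟨u, rfl⟩) ?_
    rintro _ ⟨u, rfl⟩
    refine ⟨⟨u - K.starProjection u, K.sub_starProjection_mem_orthogonal u⟩, ?_⟩
    have : T (K.starProjection u) = 0 := K.starProjection_apply_mem u
    simp [hf, this]
  obtain ⟨C, hC⟩ := f.antilipschitz_of_injective_of_isClosed_range hinj (hr ▸ hT)
  refine ⟨(C + 1 : ℝ)⁻¹, by positivity, fun u hu => ?_⟩
  have := hC.le_mul_norm (map_zero f) ⟨u, hu⟩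
  rw [inv_mul_le_iff₀ (by positivity)]
  calc ‖u‖ ≤ C * ‖T u‖ := this
    _ ≤ _ := by nlinarith [norm_nonneg (T u)]

/-- The square roots of the positive and of the negative part of a self-adjoint operator. -/
theorem exists_sq_sub_sq {T : V →L[ℂ] V} (hT : IsSelfAdjoint T) :
    ∃ P N : V →L[ℂ] V, IsSelfAdjoint P ∧ IsSelfAdjoint N ∧ P * N = 0 ∧ N * P = 0 ∧
      T = P * P - N * N := by
  have c1 : Continuous fun x : ℝ => √(max x 0) := by fun_prop
  have c2 : Continuous fun x : ℝ => √(max (-x) 0) := by fun_prop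
  refine ⟨cfc (fun x : ℝ => √(max x 0)) T, cfc (fun x : ℝ => √(max (-x) 0)) T,
    cfc_predicate _ _, cfc_predicate _ _, ?_, ?_, ?_⟩
  · rw [← cfc_mul _ _ T c1.continuousOn c2.continuousOn]
    convert cfc_const_zero ℝ T using 2
    funext x
    rcases le_total x 0 with h | h <;> simp [h]
  · rw [← cfc_mul _ _ T c2.continuousOn c1.continuousOn]
    convert cfc_const_zero ℝ T using 2
    funext x
    rcases le_total x 0 with h | h <;> simp [h]
  · rw [← cfc_mul _ _ T c1.continuousOn c1.continuousOn,
      ← cfc_mul _ _ T c2.continuousOn c2.continuousOn,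
      ← cfc_sub _ _ T (by fun_prop) (by fun_prop)]
    conv_lhs => rw [← cfc_id ℝ T hT]
    congr 1
    funext x
    rcases le_total x 0 with h | h <;> simp [h]

theorem re_inner_self {V : Type*} [NormedAddCommGroup V] [InnerProductSpace ℂ V] (u : V) :
    (⟪u, u⟫_ℂ).re = ‖u‖ ^ 2 := by
  simpa using inner_self_eq_norm_sq (𝕜 := ℂ) u

theorem _root_.IsSelfAdjoint.inner_clm {T : V →L[ℂ] V} (hT : IsSelfAdjoint T) (u v : V) :
    ⟪T u, v⟫_ℂ = ⟪u, T v⟫_ℂ := by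
  rw [← ContinuousLinearMap.adjoint_inner_right, ← ContinuousLinearMap.star_eq_adjoint, hT.star_eq]

/-- A self-adjoint operator with closed range splits the space into its kernel and two subspaces
on which it is positive, respectively negative, definite. -/
theorem exists_definite_splitting {T : V →L[ℂ] V} (hT : IsSelfAdjoint T)
    (hr : IsClosed (range T)) :
    ∃ (δ : ℝ) (Wp Wm : Submodule ℂ V), 0 < δ ∧ (∀ u ∈ Wp, δ * ‖u‖ ^ 2 ≤ (⟪u, T u⟫_ℂ).re) ∧
      (∀ u ∈ Wm, (⟪u, T u⟫_ℂ).re ≤ -(δ * ‖u‖ ^ 2)) ∧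
      LinearMap.ker T.toLinearMap ⊔ Wp ⊔ Wm = ⊤ := by
  obtain ⟨P, N, hP, hN, hPN, hNP, hTPN⟩ := exists_sq_sub_sq hT
  obtain ⟨c, hc, hcT⟩ := exists_norm_le_of_isClosed_range hr
  set K : Submodule ℂ V := LinearMap.ker T.toLinearMap with hK
  set Z : Submodule ℂ V := LinearMap.ker N.toLinearMap with hZ
  have : CompleteSpace K := (ContinuousLinearMap.isClosed_ker T).completeSpace_coe
  have : CompleteSpace Z := (ContinuousLinearMap.isClosed_ker N).completeSpace_coe
  have hTu : ∀ u, T u = P (P u) - N (N u) := fun u => by rw [hTPN]; rfl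
  have hPNu : ∀ u, P (N u) = 0 := fun u => DFunLike.congr_fun hPN u
  have hNPu : ∀ u, N (P u) = 0 := fun u => DFunLike.congr_fun hNP u
  have sq0 : ∀ {S : V →L[ℂ] V}, IsSelfAdjoint S → ∀ u, S (S u) = 0 → S u = 0 := by
    intro S hS u h
    rw [← inner_self_eq_zero (𝕜 := ℂ), hS.inner_clm, h, inner_zero_right]
  have hKZ : K ≤ Z := by
    intro k hk
    have h1 : P (P k) - N (N k) = 0 := by rw [← hTu]; exact hk
    have h2 : N (N (N k)) = 0 := by
      have := congrArg N h1
      rw [map_sub, hNPu, map_zero, zero_sub, neg_eq_zero] at this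
      exact this
    exact sq0 hN _ (sq0 hN _ h2)
  set D : ℝ := ‖P‖ + ‖N‖ + 1 with hD
  have hD0 : 0 < D := by positivity
  have est : ∀ {S : V →L[ℂ] V}, ‖S‖ ≤ D → ∀ u, c * ‖u‖ ≤ ‖S (S u)‖ →
      (c / D) ^ 2 * ‖u‖ ^ 2 ≤ ‖S u‖ ^ 2 := by
    intro S hS u h
    rw [← mul_pow]
    refine pow_le_pow_left₀ (by positivity) ?_ 2
    rw [div_mul_eq_mul_div, div_le_iff₀ hD0, mul_comm _ D]
    calc c * ‖u‖ ≤ ‖S (S u)‖ := h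
      _ ≤ ‖S‖ * ‖S u‖ := S.le_opNorm _
      _ ≤ D * ‖S u‖ := by gcongr
  have innsq : ∀ {S : V →L[ℂ] V}, IsSelfAdjoint S → ∀ u, (⟪u, S (S u)⟫_ℂ).re = ‖S u‖ ^ 2 := by
    intro S hS u
    rw [← hS.inner_clm, re_inner_self]
  refine ⟨(c / D) ^ 2, Z ⊓ Kᗮ, Zᗮ, by positivity, ?_, ?_, ?_⟩
  · rintro u ⟨hu1, hu2⟩
    have e : T u = P (P u) := by rw [hTu, show N u = 0 from hu1, map_zero, sub_zero]
    rw [e, innsq hP]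
    exact est (by linarith [norm_nonneg N]) u (e ▸ hcT u hu2)
  · intro u hu
    have h1 : P u = 0 := by
      have : P (P u) ∈ Z := by change N (P (P u)) = 0; exact hNPu _
      rw [← inner_self_eq_zero (𝕜 := ℂ), ← hP.inner_clm]
      exact hu _ this
    have e : T u = -N (N u) := by rw [hTu, h1, map_zero, zero_sub]
    rw [e, inner_neg_right, Complex.neg_re, innsq hN, neg_le_neg_iff]
    refine est (by linarith [norm_nonneg P]) u ?_
    rw [← norm_neg (N (N u)), ← e]
    exact hcT u (Submodule.orthogonal_le hKZ hu)
  · rw [eq_top_iff]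
    intro u _
    set z := Z.starProjection u
    have hz : z ∈ Z := Z.starProjection_apply_mem u
    have e : u = K.starProjection z + (z - K.starProjection z) + (u - z) := by abel
    rw [e]
    refine Submodule.add_mem_sup (Submodule.add_mem_sup (K.starProjection_apply_mem z) ⟨?_, ?_⟩)
      (Z.sub_starProjection_mem_orthogonal u)
    · exact Z.sub_mem hz (hKZ (K.starProjection_apply_mem z))
    · exact K.sub_starProjection_mem_orthogonal z

/-- An operator which is coercive on the orthogonal complement of a finite-dimensional subspace
has a finite-dimensional kernel and a closed range. -/
theorem finiteDimensional_ker_isClosed_range {T : V →L[ℂ] V} {Z : Submodule ℂ V}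
    [FiniteDimensional ℂ Z] {δ : ℝ} (hδ : 0 < δ)
    (h : ∀ u ∈ Zᗮ, δ * ‖u‖ ^ 2 ≤ (⟪u, T u⟫_ℂ).re) :
    FiniteDimensional ℂ (LinearMap.ker T.toLinearMap) ∧ IsClosed (range T) := by
  have hb : ∀ u ∈ Zᗮ, δ * ‖u‖ ≤ ‖T u‖ := by
    intro u hu
    rcases eq_or_ne u 0 with rfl | h0
    · simp
    have h1 : (⟪u, T u⟫_ℂ).re ≤ ‖u‖ * ‖T u‖ :=
      (Complex.re_le_norm _).trans (norm_inner_le_norm _ _)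
    have h2 : 0 < ‖u‖ := norm_pos_iff.2 h0
    nlinarith [h u hu]
  constructor
  · refine FiniteDimensional.of_injective
      (Z.orthogonalProjectionOnto.toLinearMap.comp (LinearMap.ker T.toLinearMap).subtype) ?_
    rw [injective_iff_map_eq_zero]
    rintro ⟨u, hu⟩ h0
    have hu' : u ∈ Zᗮ := by
      rw [← Submodule.orthogonalProjectionOnto_eq_zero_iff]
      exact h0
    have := hb u hu'
    rw [show T u = 0 from hu, norm_zero] at this
    refine Subtype.ext (norm_eq_zero.1 ?_)
    change ‖u‖ = 0
    nlinarith [norm_nonneg u]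
  · have hA : AntilipschitzWith ⟨δ⁻¹, by positivity⟩ (T ∘L Zᗮ.subtypeL) := by
      refine AddMonoidHomClass.antilipschitz_of_bound _ fun u => ?_
      change ‖(u : V)‖ ≤ δ⁻¹ * ‖T u‖
      rw [le_inv_mul_iff₀ hδ]
      exact hb u u.2
    have hcl := hA.isClosed_range (T ∘L Zᗮ.subtypeL).uniformContinuous
    have e1 : ((LinearMap.range (T ∘L Zᗮ.subtypeL).toLinearMap : Submodule ℂ V) : Set V) =
      range (T ∘L Zᗮ.subtypeL) := rfl
    rw [← e1] at hcl
    have := Submodule.isClosed_sup_finiteDimensional _ (Z.map T.toLinearMap) hcl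
    convert this using 1
    refine subset_antisymm ?_ ?_
    · rintro _ ⟨u, rfl⟩
      have e : T u = T (u - Z.starProjection u) + T (Z.starProjection u) := by
        rw [← map_add]; congr 1; abel
      rw [e]
      exact Submodule.add_mem_sup ⟨⟨_, Z.sub_starProjection_mem_orthogonal u⟩, rfl⟩
        ⟨_, Z.starProjection_apply_mem u, rfl⟩
    · have : LinearMap.range (T ∘L Zᗮ.subtypeL).toLinearMap ⊔ Z.map T.toLinearMap ≤
          LinearMap.range T.toLinearMap := by
        refine sup_le ?_ (LinearMap.map_le_range)
        rintro _ ⟨u, rfl⟩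
        exact ⟨u, rfl⟩
      exact this

theorem exists_submodule_le_finrank_eq {V : Type*} [AddCommGroup V] [Module ℂ V]
    {L : Submodule ℂ V} {n : ℕ} (hn : n ≤ Module.rank ℂ L) :
    ∃ L' ≤ L, Module.finrank ℂ L' = n := by
  obtain ⟨f, hf⟩ := exists_linearIndependent_of_le_rank hn
  refine ⟨(Submodule.span ℂ (range f)).map L.subtype, Submodule.map_subtype_le _ _, ?_⟩
  rw [Submodule.finrank_map_subtype_eq, finrank_span_eq_card hf, Fintype.card_fin]

theorem exists_mem_inf_ne_zero {V : Type*} [AddCommGroup V] [Module ℂ V] {W K L : Submodule ℂ V}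
    [FiniteDimensional ℂ K] (hWK : W ⊔ K = ⊤) (h : Module.finrank ℂ K < Module.finrank ℂ L) :
    ∃ u ∈ L, u ∈ W ∧ u ≠ 0 := by
  have hs : Function.Surjective (W.mkQ.comp K.subtype) := by
    intro q
    obtain ⟨v, rfl⟩ := W.mkQ_surjective q
    obtain ⟨w, hw, k, hk, rfl⟩ := Submodule.mem_sup.1 (hWK ▸ Submodule.mem_top : v ∈ W ⊔ K)
    refine ⟨⟨k, hk⟩, ?_⟩
    simpa using hw
  have : FiniteDimensional ℂ (V ⧸ W) := Module.Finite.of_surjective _ hs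
  have hle : Module.finrank ℂ (V ⧸ W) ≤ Module.finrank ℂ K := by
    rw [← finrank_top ℂ (V ⧸ W), ← LinearMap.range_eq_top.2 hs]
    exact LinearMap.finrank_range_le _
  by_contra! hno
  have hi : Function.Injective (W.mkQ.comp L.subtype) := by
    rw [injective_iff_map_eq_zero]
    rintro ⟨u, hu⟩ h0
    have h0' : u ∈ W := by simpa using h0
    exact Subtype.ext (hno u hu h0')
  have := LinearMap.finrank_le_finrank_of_injective hi
  omega

/-- If the dimension of the subspaces on which a self-adjoint operator is negative is bounded, then
the operator is non-negative on a subspace of finite codimension. -/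
theorem exists_nonneg_on_orthogonal {T : V →L[ℂ] V} (hT : IsSelfAdjoint T) {n : ℕ}
    (h : ∀ L : Submodule ℂ V, Module.finrank ℂ L = n → ∃ u ∈ L, u ≠ 0 ∧ 0 ≤ (⟪u, T u⟫_ℂ).re) :
    ∃ Z : Submodule ℂ V, FiniteDimensional ℂ Z ∧ ∀ u ∈ Zᗮ, 0 ≤ (⟪u, T u⟫_ℂ).re := by
  classical
  -- `L` is a negative subspace of the largest dimension
  let Q : ℕ → Prop := fun m => ∃ L : Submodule ℂ V, FiniteDimensional ℂ L ∧
    Module.finrank ℂ L = m ∧ ∀ u ∈ L, u ≠ 0 → (⟪u, T u⟫_ℂ).re < 0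
  have hQ0 : Q 0 := ⟨⊥, inferInstance, finrank_bot _ _, fun u hu h0 => absurd hu h0⟩
  have hQn : ∀ m, Q m → m < n := by
    rintro m ⟨L, hL, rfl, hneg⟩
    by_contra! hm
    obtain ⟨L', hL', hd⟩ := exists_submodule_le_finrank_eq (L := L) (n := n)
      (by rw [← Module.finrank_eq_rank]; exact_mod_cast hm)
    obtain ⟨u, hu, hu0, hpos⟩ := h L' hd
    exact absurd (hneg u (hL' hu) hu0) (not_lt.2 hpos)
  obtain ⟨m, ⟨L, hL, hd, hneg⟩, hmax⟩ : ∃ m, Q m ∧ ∀ k, Q k → k ≤ m :=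
    ⟨Nat.findGreatest Q n, Nat.findGreatest_spec (Nat.zero_le n) hQ0,
      fun k hk => Nat.le_findGreatest (hQn k hk).le hk⟩
  refine ⟨L.map T.toLinearMap, inferInstance, fun u hu => ?_⟩
  have hort : ∀ l ∈ L, ⟪l, T u⟫_ℂ = 0 := fun l hl => by
    rw [← hT.inner_clm]; exact hu _ ⟨l, hl, rfl⟩
  by_contra! hlt
  have huL : u ∉ L := fun hmem => by
    rw [hort u hmem] at hlt; simp at hlt
  have hu0 : u ≠ 0 := fun h0 => huL (h0 ▸ L.zero_mem)
  have hdis : Disjoint L (ℂ ∙ u) := by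
    exact (Submodule.disjoint_span_singleton' hu0).2 huL
  have : m + 1 ≤ m := by
    refine hmax _ ⟨L ⊔ ℂ ∙ u, inferInstance, ?_, ?_⟩
    · have := Submodule.finrank_sup_add_finrank_inf_eq L (ℂ ∙ u)
      rw [hdis.eq_bot, finrank_bot, finrank_span_singleton hu0, hd] at this
      simpa using this
    · intro w hw hw0
      obtain ⟨l, hl, v, hv, rfl⟩ := Submodule.mem_sup.1 hw
      obtain ⟨t, rfl⟩ := Submodule.mem_span_singleton.1 hv
      have e1 : ⟪u, T l⟫_ℂ = 0 := by
        rw [← hT.inner_clm, ← inner_conj_symm, hort l hl, map_zero]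
      have e : (⟪l + t • u, T (l + t • u)⟫_ℂ).re =
          (⟪l, T l⟫_ℂ).re + ‖t‖ ^ 2 * (⟪u, T u⟫_ℂ).re := by
        rw [map_add, map_smul, inner_add_left, inner_add_right, inner_add_right, inner_smul_left,
          inner_smul_left, inner_smul_right, inner_smul_right, hort l hl, e1, mul_zero, mul_zero,
          add_zero, zero_add, ← mul_assoc, Complex.conj_mul', Complex.add_re, ← Complex.ofReal_pow,
          Complex.re_ofReal_mul]
      rw [e]
      by_cases hl0 : l = 0
      · have ht : t ≠ 0 := by rintro rfl; simp [hl0] at hw0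
        have : 0 < ‖t‖ ^ 2 := by positivity
        simp only [hl0, map_zero, inner_zero_right, Complex.zero_re, zero_add]
        nlinarith
      · nlinarith [hneg l hl hl0, sq_nonneg ‖t‖]
  omega

end SelfAdjoint

/-! ### The min-max numbers of a form -/

section MinMax

variable {V H : Type*} [NormedAddCommGroup V] [InnerProductSpace ℂ V] [CompleteSpace V]
  [NormedAddCommGroup H] [InnerProductSpace ℂ H] [CompleteSpace H]
  {j : V →L[ℂ] H} {B : H →L[ℂ] H}

/-- The bounded operator in `V` which represents the form `⟪v, u⟫ + ⟪j v, B (j u)⟫` with respect to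
the inner product of `V`. -/
noncomputable def formOp (j : V →L[ℂ] H) (B : H →L[ℂ] H) : V →L[ℂ] V :=
  1 + ContinuousLinearMap.adjoint j ∘L B ∘L j

/-- The min-max numbers of the form `⟪v, u⟫ + ⟪j v, B (j u)⟫`, relative to the norm of `H`. -/
noncomputable def minmax (j : V →L[ℂ] H) (B : H →L[ℂ] H) (n : ℕ) : EReal :=
  ⨅ (L : Submodule ℂ V) (_ : Module.finrank ℂ L = n), ⨆ (u : V) (_ : u ∈ L ∧ u ≠ 0),
    (((⟪u, formOp j B u⟫_ℂ).re / ‖j u‖ ^ 2 : ℝ) : EReal)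

/-- The limit of the min-max numbers. -/
noncomputable def minmaxSup (j : V →L[ℂ] H) (B : H →L[ℂ] H) : EReal :=
  ⨆ (n : ℕ) (_ : 1 ≤ n), minmax j B n

theorem inner_formOp (v u : V) : ⟪v, formOp j B u⟫_ℂ = ⟪v, u⟫_ℂ + ⟪j v, B (j u)⟫_ℂ := by
  simp [formOp, ContinuousLinearMap.adjoint_inner_right]

theorem isSelfAdjoint_formOp (hB : IsSelfAdjoint B) : IsSelfAdjoint (formOp j B) := by
  rw [ContinuousLinearMap.isSelfAdjoint_iff_isSymmetric]
  intro u v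
  change ⟪formOp j B u, v⟫_ℂ = ⟪u, formOp j B v⟫_ℂ
  rw [← inner_conj_symm, inner_formOp, inner_formOp, map_add, inner_conj_symm, inner_conj_symm,
    hB.inner_clm]

theorem formOp_sub_smul (z : ℂ) : formOp j (B - z • 1) =
    formOp j B - z • (ContinuousLinearMap.adjoint j ∘L j) := by
  ext u
  simp [formOp, add_sub_assoc]

theorem isSelfAdjoint_sub_smul (hB : IsSelfAdjoint B) (c : ℝ) :
    IsSelfAdjoint (B - (c : ℂ) • 1) :=
  hB.sub (IsSelfAdjoint.smul (by simp [IsSelfAdjoint]) (.one _))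

theorem re_inner_formOp_sub_smul (c : ℝ) (u : V) :
    (⟪u, formOp j (B - (c : ℂ) • 1) u⟫_ℂ).re =
      (⟪u, formOp j B u⟫_ℂ).re - c * ‖j u‖ ^ 2 := by
  rw [inner_formOp, inner_formOp]
  simp only [sub_apply, inner_sub_right, smul_apply, one_apply_eq_self, inner_smul_right,
    Complex.add_re, Complex.sub_re]
  rw [Complex.re_ofReal_mul, re_inner_self, re_inner_self]
  ring

theorem re_inner_formOp_ge (u : V) :
    ‖u‖ ^ 2 - ‖B‖ * ‖j u‖ ^ 2 ≤ (⟪u, formOp j B u⟫_ℂ).re := by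
  rw [inner_formOp, Complex.add_re, re_inner_self]
  have h1 : |(⟪j u, B (j u)⟫_ℂ).re| ≤ ‖B‖ * ‖j u‖ ^ 2 := by
    refine (Complex.abs_re_le_norm _).trans ((norm_inner_le_norm _ _).trans ?_)
    calc ‖j u‖ * ‖B (j u)‖ ≤ ‖j u‖ * (‖B‖ * ‖j u‖) := by gcongr; exact B.le_opNorm _
      _ = _ := by ring
  have h2 := (abs_le.1 h1).1
  linarith

theorem minmax_le (hj : Function.Injective j) {n : ℕ} {L : Submodule ℂ V}
    (hL : Module.finrank ℂ L = n) {r : ℝ}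
    (h : ∀ u ∈ L, (⟪u, formOp j B u⟫_ℂ).re ≤ r * ‖j u‖ ^ 2) : minmax j B n ≤ r := by
  refine (iInf₂_le L hL).trans (iSup₂_le fun u hu => ?_)
  rw [EReal.coe_le_coe_iff]
  have : 0 < ‖j u‖ := norm_pos_iff.2 ((map_ne_zero_iff j hj).2 hu.2)
  rw [div_le_iff₀ (by positivity)]
  exact h u hu.1

theorem le_minmax (hj : Function.Injective j) {n : ℕ} {r : ℝ}
    (h : ∀ L : Submodule ℂ V, Module.finrank ℂ L = n →
      ∃ u ∈ L, u ≠ 0 ∧ r * ‖j u‖ ^ 2 ≤ (⟪u, formOp j B u⟫_ℂ).re) : r ≤ minmax j B n := by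
  refine le_iInf₂ fun L hL => ?_
  obtain ⟨u, hu, hu0, hle⟩ := h L hL
  refine le_trans ?_ (le_iSup₂ (f := fun (u : V) (_ : u ∈ L ∧ u ≠ 0) =>
    (((⟪u, formOp j B u⟫_ℂ).re / ‖j u‖ ^ 2 : ℝ) : EReal)) u ⟨hu, hu0⟩)
  rw [EReal.coe_le_coe_iff]
  have : 0 < ‖j u‖ := norm_pos_iff.2 ((map_ne_zero_iff j hj).2 hu0)
  rwa [le_div_iff₀ (by positivity)]

theorem exists_lt_of_lt_minmax (hj : Function.Injective j) {n : ℕ} {r : ℝ}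
    (h : r < minmax j B n) (L : Submodule ℂ V) (hL : Module.finrank ℂ L = n) :
      ∃ u ∈ L, u ≠ 0 ∧ r * ‖j u‖ ^ 2 < (⟪u, formOp j B u⟫_ℂ).re := by
  have h1 := h.trans_le (iInf₂_le L hL)
  obtain ⟨u, h2⟩ := lt_iSup_iff.1 h1
  obtain ⟨⟨hu, hu0⟩, h3⟩ := lt_iSup_iff.1 h2
  refine ⟨u, hu, hu0, ?_⟩
  rw [EReal.coe_lt_coe_iff] at h3
  have : 0 < ‖j u‖ := norm_pos_iff.2 ((map_ne_zero_iff j hj).2 hu0)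
  rwa [lt_div_iff₀ (by positivity)] at h3

theorem neg_norm_le_minmax (hj : Function.Injective j) {n : ℕ} (hn : 1 ≤ n) :
    ((-‖B‖ : ℝ) : EReal) ≤ minmax j B n := by
  refine le_minmax hj fun L hL => ?_
  have : L ≠ ⊥ := by rintro rfl; simp at hL; omega
  obtain ⟨u, hu, hu0⟩ := Submodule.exists_mem_ne_zero_of_ne_bot this
  refine ⟨u, hu, hu0, ?_⟩
  have := re_inner_formOp_ge (j := j) (B := B) u
  nlinarith [sq_nonneg ‖u‖]

/-- Below a min-max number, the shifted form operator has a finite-dimensional kernel and a closed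
range: it is coercive on the subspace of finite codimension on which the form is above `c`. -/
theorem finiteDimensional_ker_isClosed_range_of_lt_minmax (hj : Function.Injective j)
    (hB : IsSelfAdjoint B) {n : ℕ} {c : ℝ} (h : c < minmax j B n) :
    FiniteDimensional ℂ (LinearMap.ker (formOp j (B - (c : ℂ) • 1)).toLinearMap) ∧
      IsClosed (range (formOp j (B - (c : ℂ) • 1))) := by
  obtain ⟨c', hcc', hc'⟩ := EReal.lt_iff_exists_real_btwn.1 h
  rw [EReal.coe_lt_coe_iff] at hcc'
  obtain ⟨Z, hZ, hpos⟩ := exists_nonneg_on_orthogonal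
    (isSelfAdjoint_formOp (j := j) (isSelfAdjoint_sub_smul hB c')) (n := n) fun L hL => by
      obtain ⟨u, hu, hu0, hlt⟩ := exists_lt_of_lt_minmax hj hc' L hL
      exact ⟨u, hu, hu0, by rw [re_inner_formOp_sub_smul]; linarith⟩
  set C := ‖B - (c : ℂ) • (1 : H →L[ℂ] H)‖ with hC
  have hC0 : 0 ≤ C := norm_nonneg _
  refine finiteDimensional_ker_isClosed_range (Z := Z) (δ := (c' - c) / (C + (c' - c)))
    (div_pos (by linarith) (by linarith)) fun u hu => ?_
  have h1 := hpos u hu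
  have h2 := re_inner_formOp_ge (j := j) (B := B - (c : ℂ) • 1) u
  rw [re_inner_formOp_sub_smul] at h1 h2 ⊢
  rw [← hC] at h2
  rw [div_mul_eq_mul_div, div_le_iff₀ (by linarith)]
  nlinarith

/-- If `formOp j (B - c)` has a finite-dimensional kernel and a closed range, there is a gap in the
min-max numbers around `c`, in which at most `dim ker` of them can lie at `c` itself. -/
theorem minmax_dichotomy (hj : Function.Injective j) (hB : IsSelfAdjoint B) {c : ℝ}
    (hK : FiniteDimensional ℂ (LinearMap.ker (formOp j (B - (c : ℂ) • 1)).toLinearMap))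
    (hr : IsClosed (range (formOp j (B - (c : ℂ) • 1)))) :
    ∃ δ : ℝ, 0 < δ ∧ ((∀ n, minmax j B n ≤ (c - δ : ℝ)) ∨
      ∃ m : ℕ, (∀ n ≤ m, minmax j B n ≤ (c - δ : ℝ)) ∧
        ∀ n, m + Module.finrank ℂ (LinearMap.ker (formOp j (B - (c : ℂ) • 1)).toLinearMap) < n →
          ((c + δ : ℝ) : EReal) ≤ minmax j B n) := by
  obtain ⟨δ, Wp, Wm, hδ, hp, hm, htop⟩ := exists_definite_splitting
    (isSelfAdjoint_formOp (j := j) (isSelfAdjoint_sub_smul hB c)) hr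
  set K := LinearMap.ker (formOp j (B - (c : ℂ) • 1)).toLinearMap
  have hnorm : ∀ u, δ / (‖j‖ ^ 2 + 1) * ‖j u‖ ^ 2 ≤ δ * ‖u‖ ^ 2 := by
    intro u
    rw [div_mul_eq_mul_div, div_le_iff₀ (by positivity), mul_assoc]
    gcongr
    calc ‖j u‖ ^ 2 ≤ (‖j‖ * ‖u‖) ^ 2 := by gcongr; exact j.le_opNorm u
      _ ≤ _ := by nlinarith [sq_nonneg ‖u‖]
  have low : ∀ n : ℕ, n ≤ Module.rank ℂ Wm →
      minmax j B n ≤ (c - δ / (‖j‖ ^ 2 + 1) : ℝ) := by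
    intro n hn
    obtain ⟨L, hLW, hL⟩ := exists_submodule_le_finrank_eq hn
    refine minmax_le hj hL fun u hu => ?_
    have := hm u (hLW hu)
    rw [re_inner_formOp_sub_smul] at this
    linarith [hnorm u]
  refine ⟨δ / (‖j‖ ^ 2 + 1), by positivity, ?_⟩
  by_cases hfin : FiniteDimensional ℂ Wm
  · refine Or.inr ⟨Module.finrank ℂ Wm, fun n hn => low n ?_, fun n hn => ?_⟩
    · rw [← Module.finrank_eq_rank]; exact_mod_cast hn
    · refine le_minmax hj fun L hL => ?_
      obtain ⟨u, hu, huW, hu0⟩ := exists_mem_inf_ne_zero (W := Wp) (K := K ⊔ Wm) (L := L)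
        (by rw [← htop, sup_left_comm, sup_assoc]) (by
          have := Submodule.finrank_add_le_finrank_add_finrank K Wm
          omega)
      refine ⟨u, hu, hu0, ?_⟩
      have := hp u huW
      rw [re_inner_formOp_sub_smul] at this
      linarith [hnorm u]
  · refine Or.inl fun n => low n ?_
    have : Cardinal.aleph0 ≤ Module.rank ℂ Wm := by
      rw [← not_lt, Module.rank_lt_aleph0_iff]
      exact hfin
    exact (Cardinal.natCast_lt_aleph0.le).trans this

theorem minmax_le_minmaxSup {n : ℕ} (hn : 1 ≤ n) : minmax j B n ≤ minmaxSup j B :=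
  le_iSup₂ (f := fun (n : ℕ) (_ : 1 ≤ n) => minmax j B n) n hn

theorem lt_minmaxSup_iff {r : EReal} : r < minmaxSup j B ↔ ∃ n, 1 ≤ n ∧ r < minmax j B n := by
  simp [minmaxSup, lt_iSup_iff]

/-- For `c` below the limit of the min-max numbers, the kernel of `formOp j (B - c)` is
finite-dimensional, and at most as many min-max numbers as its dimension are equal to `c`. -/
theorem minmax_structure (hj : Function.Injective j) (hB : IsSelfAdjoint B) {c : ℝ}
    (h : c < minmaxSup j B) :
    FiniteDimensional ℂ (LinearMap.ker (formOp j (B - (c : ℂ) • 1)).toLinearMap) ∧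
    ∃ m : ℕ, (∀ n ≤ m, minmax j B n < c) ∧
      ∀ n, m + Module.finrank ℂ (LinearMap.ker (formOp j (B - (c : ℂ) • 1)).toLinearMap) < n →
        c < minmax j B n := by
  obtain ⟨n, hn, hlt⟩ := lt_minmaxSup_iff.1 h
  obtain ⟨hK, hr⟩ := finiteDimensional_ker_isClosed_range_of_lt_minmax hj hB hlt
  refine ⟨hK, ?_⟩
  obtain ⟨δ, hδ, h1 | ⟨m, h1, h2⟩⟩ := minmax_dichotomy hj hB hK hr
  · have := hlt.trans_le (h1 n)
    rw [EReal.coe_lt_coe_iff] at this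
    linarith
  · refine ⟨m, fun k hk => (h1 k hk).trans_lt ?_, fun k hk => lt_of_lt_of_le ?_ (h2 k hk)⟩ <;>
    · rw [EReal.coe_lt_coe_iff]; linarith

theorem exists_forall_lt_minmax (hj : Function.Injective j) (hB : IsSelfAdjoint B) {c : ℝ}
    (h : c < minmaxSup j B) : ∃ M : ℕ, ∀ n, M < n → c < minmax j B n := by
  obtain ⟨-, m, -, h2⟩ := minmax_structure hj hB h
  exact ⟨_, h2⟩

/-- A min-max number below the limit of the min-max numbers is an eigenvalue, of a multiplicity at
least the number of times that it is repeated. -/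
theorem card_minmax_eq_le (hj : Function.Injective j) (hB : IsSelfAdjoint B) {c : ℝ}
    (h : c < minmaxSup j B) {s : Finset ℕ} (hs : ∀ n ∈ s, minmax j B n = c) :
    s.card ≤ Module.finrank ℂ (LinearMap.ker (formOp j (B - (c : ℂ) • 1)).toLinearMap) := by
  obtain ⟨-, m, h1, h2⟩ := minmax_structure hj hB h
  have : s ⊆ Finset.Ioc m (m + Module.finrank ℂ
      (LinearMap.ker (formOp j (B - (c : ℂ) • 1)).toLinearMap)) := by
    intro n hn
    rw [Finset.mem_Ioc]
    constructor <;> by_contra! hlt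
    · exact (h1 n hlt).ne (hs n hn)
    · exact (h2 n hlt).ne' (hs n hn)
  simpa using Finset.card_le_card this

/-- The limit of the min-max numbers is a point at which the shifted form operator cannot have both a
finite-dimensional kernel and a closed range: there would be a gap in the numbers around it. -/
theorem not_finiteDimensional_ker_isClosed_range (hj : Function.Injective j)
    (hB : IsSelfAdjoint B) {c : ℝ} (h : minmaxSup j B = c) :
    ¬ (FiniteDimensional ℂ (LinearMap.ker (formOp j (B - (c : ℂ) • 1)).toLinearMap) ∧
      IsClosed (range (formOp j (B - (c : ℂ) • 1)))) := by
  rintro ⟨hK, hr⟩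
  obtain ⟨δ, hδ, h1 | ⟨m, -, h2⟩⟩ := minmax_dichotomy hj hB hK hr
  · have : minmaxSup j B ≤ (c - δ : ℝ) := iSup₂_le fun n _ => h1 n
    rw [h, EReal.coe_le_coe_iff] at this
    linarith
  · have := (h2 _ (Nat.lt_succ_self _)).trans (minmax_le_minmaxSup (Nat.succ_pos _))
    rw [h, EReal.coe_le_coe_iff] at this
    linarith

end MinMax

/-! ### The spectrum of an unbounded operator -/

section Unbounded

variable {X : Type*} [NormedAddCommGroup X] [InnerProductSpace ℂ X] {A : X →ₗ.[ℂ] X}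

theorem mem_preimageShift {z : ℂ} {W : Submodule ℂ X} {x : X} :
    x ∈ preimageShift A z W ↔ ∃ f, (x, f) ∈ A.graph ∧ f - z • x ∈ W := by
  constructor
  · rintro ⟨y, hy, rfl⟩
    exact ⟨A y, A.mem_graph y, hy⟩
  · rintro ⟨f, hf, hW⟩
    obtain ⟨y, rfl, rfl⟩ := A.mem_graph_iff.1 hf
    exact ⟨y, hW, rfl⟩

theorem mem_eigenspace {z : ℂ} {x : X} : x ∈ eigenspace A z ↔ (x, z • x) ∈ A.graph := by
  rw [eigenspace, mem_preimageShift]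
  constructor
  · rintro ⟨f, hf, h0⟩
    rwa [← sub_eq_zero.1 ((Submodule.mem_bot ℂ).1 h0)]
  · exact fun h => ⟨_, h, by simp⟩

theorem mem_range_shift {z : ℂ} {g : X} :
    (g ∈ range fun x : A.domain => A x - z • (x : X)) ↔ ∃ x, (x, g + z • x) ∈ A.graph := by
  constructor
  · rintro ⟨x, rfl⟩
    exact ⟨x, by simp⟩
  · rintro ⟨x, hx⟩
    obtain ⟨y, rfl, hy⟩ := A.mem_graph_iff.1 hx
    exact ⟨y, by simp [hy]⟩

/-- At a point `z` outside the essential spectrum, `A - z` has a finite-dimensional kernel and a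
closed range. -/
theorem finiteDimensional_eigenspace_isClosed_range {z : ℂ} (hz : z ∉ essSpec A) :
    FiniteDimensional ℂ (eigenspace A z) ∧
      IsClosed (range fun x : A.domain => A x - z • (x : X)) := by
  by_cases hs : z ∈ spec A
  · have hd : z ∈ discreteSpec A := by
      by_contra hd
      exact hz ⟨hs, hd⟩
    obtain ⟨-, -, -, hr, hc⟩ := hd
    refine ⟨?_, hc⟩
    have : eigenspace A z ≤ rootSpace A z := le_iSup (kerPow A z) 1
    exact Submodule.finiteDimensional_of_le this
  · obtain ⟨R, h1, h2⟩ := not_not.1 hs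
    constructor
    · have : eigenspace A z = ⊥ := by
        rw [eq_bot_iff]
        intro x hx
        obtain ⟨y, rfl, hy⟩ := A.mem_graph_iff.1 (mem_eigenspace.1 hx)
        have := h2 y
        rw [hy, sub_self, map_zero] at this
        exact this.symm
      rw [this]
      infer_instance
    · convert isClosed_univ
      rw [range_eq_univ]
      intro y
      obtain ⟨hy, e⟩ := h1 y
      exact ⟨⟨R y, hy⟩, e⟩

theorem mem_spec_of_eigenspace_ne_bot {z : ℂ} (h : eigenspace A z ≠ ⊥) : z ∈ spec A := by
  rintro ⟨R, -, h2⟩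
  refine h (eq_bot_iff.2 fun x hx => ?_)
  obtain ⟨y, rfl, hy⟩ := A.mem_graph_iff.1 (mem_eigenspace.1 hx)
  have := h2 y
  rw [hy, sub_self, map_zero] at this
  exact this.symm

end Unbounded

/-! ### The operator associated with a form -/

section FormOperator

variable {V H : Type*} [NormedAddCommGroup V] [InnerProductSpace ℂ V] [CompleteSpace V]
  [NormedAddCommGroup H] [InnerProductSpace ℂ H] [CompleteSpace H]
  {j : V →L[ℂ] H} {B : H →L[ℂ] H} {A : H →ₗ.[ℂ] H}

/-- The unbounded operator `A` in `H` is associated with the form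
`⟪v, u⟫ + ⟪j v, B (j u)⟫` on `V`. -/
def IsFormOperator (j : V →L[ℂ] H) (B : H →L[ℂ] H) (A : H →ₗ.[ℂ] H) : Prop :=
  ∀ x f, (x, f) ∈ A.graph ↔ ∃ u, j u = x ∧ formOp j B u = ContinuousLinearMap.adjoint j f

theorem exists_mul_norm_sq_le {V H : Type*} [NormedAddCommGroup V] [NormedSpace ℂ V]
    [NormedAddCommGroup H] [NormedSpace ℂ H] {j : V →L[ℂ] H} (hj : Function.Injective j)
    (L : Submodule ℂ V) [FiniteDimensional ℂ L] :
    ∃ κ : ℝ, 0 < κ ∧ ∀ u ∈ L, κ * ‖u‖ ^ 2 ≤ ‖j u‖ ^ 2 := by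
  obtain ⟨D, hD, hD'⟩ := LinearMap.exists_antilipschitzWith (j.toLinearMap.comp L.subtype)
    (LinearMap.ker_eq_bot.2 (hj.comp Subtype.val_injective))
  refine ⟨((D : ℝ) ^ 2)⁻¹, by positivity, fun k hk => ?_⟩
  have := hD'.le_mul_norm (map_zero _) ⟨k, hk⟩
  rw [inv_mul_le_iff₀ (by positivity), ← mul_pow]
  exact pow_le_pow_left₀ (norm_nonneg _) this 2

theorem formOp_add_apply (N : H →L[ℂ] H) (u : V) : formOp j (B + N) u =
    formOp j B u + ContinuousLinearMap.adjoint j (N (j u)) := by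
  simp [formOp, add_assoc]

theorem formOp_sub_smul_apply (z : ℂ) (u : V) : formOp j (B - z • 1) u =
    formOp j B u - ContinuousLinearMap.adjoint j (z • j u) := by
  rw [formOp_sub_smul]; simp

theorem IsFormOperator.mem_graph_shift (hA : IsFormOperator j B A) {z : ℂ} {x f : H} :
    (x, f + z • x) ∈ A.graph ↔
      ∃ u, j u = x ∧ formOp j (B - z • 1) u = ContinuousLinearMap.adjoint j f := by
  rw [hA]
  refine exists_congr fun u => and_congr_right fun hu => ?_
  rw [formOp_sub_smul_apply, hu, map_add, sub_eq_iff_eq_add]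

theorem IsFormOperator.mem_eigenspace (hA : IsFormOperator j B A) {z : ℂ} {x : H} :
    x ∈ eigenspace A z ↔ ∃ u, j u = x ∧ formOp j (B - z • 1) u = 0 := by
  rw [DampedWave.mem_eigenspace, ← zero_add (z • x), hA.mem_graph_shift, map_zero]

/-- If `T = formOp j (B - z)` is invertible, then `j T⁻¹ j†` is the resolvent at `z`. -/
theorem IsFormOperator.mem_resolventSet (hA : IsFormOperator j B A) {z : ℂ}
    (hu : IsUnit (formOp j (B - z • 1))) : z ∈ resolventSet A := by
  obtain ⟨e, he⟩ := hu
  have he1 : ∀ u, formOp j (B - z • 1) ((↑e⁻¹ : V →L[ℂ] V) u) = u := fun u => by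
    rw [← he]; exact DFunLike.congr_fun e.mul_inv u
  have he2 : ∀ u, (↑e⁻¹ : V →L[ℂ] V) (formOp j (B - z • 1) u) = u := fun u => by
    rw [← he]; exact DFunLike.congr_fun e.inv_mul u
  refine ⟨j ∘L (↑e⁻¹ : V →L[ℂ] V) ∘L ContinuousLinearMap.adjoint j, fun y => ?_, fun x => ?_⟩
  · have hg := hA.mem_graph_shift.2
      ⟨(↑e⁻¹ : V →L[ℂ] V) (ContinuousLinearMap.adjoint j y), rfl, he1 _⟩
    obtain ⟨x, hx, hx'⟩ := A.mem_graph_iff.1 hg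
    refine ⟨?_, ?_⟩
    · have := x.2
      rw [hx] at this
      exact this
    · rw [sub_eq_iff_eq_add]
      refine Eq.trans ?_ hx'
      congr 1
      exact Subtype.ext hx.symm
  · have hg : ((x : H), (A x - z • (x : H)) + z • (x : H)) ∈ A.graph := by
      rw [sub_add_cancel]; exact A.mem_graph x
    obtain ⟨u, hu, hu'⟩ := hA.mem_graph_shift.1 hg
    change j ((↑e⁻¹ : V →L[ℂ] V) (ContinuousLinearMap.adjoint j (A x - z • (x : H)))) = x
    rw [← hu', he2, hu]

/-- The range of `A - z` is closed if the range of `formOp j (B - z)` is, since it is the preimage of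
the latter under `j†`. -/
theorem IsFormOperator.range_shift (hA : IsFormOperator j B A) (z : ℂ) :
    (range fun x : A.domain => A x - z • (x : H)) =
      ContinuousLinearMap.adjoint j ⁻¹' range (formOp j (B - z • 1)) := by
  ext g
  rw [mem_range_shift]
  simp only [hA.mem_graph_shift, mem_preimage, mem_range]
  constructor
  · rintro ⟨_, u, -, hu⟩; exact ⟨u, hu⟩
  · rintro ⟨u, hu⟩; exact ⟨_, u, rfl, hu⟩

/-- At a real point the root space is the eigenspace, because the form is symmetric. -/
theorem IsFormOperator.kerPow_le (hA : IsFormOperator j B A) (hB : IsSelfAdjoint B) (c : ℝ)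
    (k : ℕ) : kerPow A c k ≤ eigenspace A c := by
  induction k with
  | zero => exact bot_le
  | succ k ih =>
    intro x hx
    obtain ⟨f, hf, hk⟩ := mem_preimageShift.1 hx
    set g := f - (c : ℂ) • x with hg
    obtain ⟨u', hu', h0⟩ := hA.mem_eigenspace.1 (ih hk)
    have hf' : (x, g + (c : ℂ) • x) ∈ A.graph := by rw [hg, sub_add_cancel]; exact hf
    obtain ⟨u, hu, hug⟩ := hA.mem_graph_shift.1 hf'
    have : g = 0 := by
      rw [← inner_self_eq_zero (𝕜 := ℂ)]
      nth_rw 1 [← hu']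
      rw [← ContinuousLinearMap.adjoint_inner_right, ← hug,
        ← (isSelfAdjoint_formOp (isSelfAdjoint_sub_smul hB c)).inner_clm, h0, inner_zero_left]
    exact mem_preimageShift.2 ⟨f, hf, by rw [← hg, this]; exact Submodule.zero_mem _⟩

/-- Two inequalities between the norms `k` and `m` of the components of a vector in the kernel and in
its orthogonal complement are solved for `k + m`; the coupling is small by `hWc`. -/
theorem le_of_coupled_le {c κ M W k m f : ℝ} (hc : 0 < c) (hκ : 0 < κ) (hM : 0 ≤ M) (hW : 0 < W)
    (hWc : W * (M + M ^ 2 / κ) ≤ c / 2) (hm : 0 ≤ m)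
    (h1 : W * κ * k ≤ f + W * M * m) (h2 : c * m ≤ f + W * M * m + W * M * k) :
    k + m ≤ ((W * κ)⁻¹ * (1 + W * M * ((1 + M / κ) * (2 / c))) + (1 + M / κ) * (2 / c)) * f := by
  have h3 : W * M * k ≤ M / κ * (f + W * M * m) := by
    calc W * M * k = M / κ * (W * κ * k) := by field_simp
      _ ≤ _ := by gcongr
  have h5 : m ≤ (1 + M / κ) * (2 / c) * f := by
    have h6 : M / κ * (W * M * m) = W * (M ^ 2 / κ) * m := by ring
    have h7 : W * (M + M ^ 2 / κ) * m ≤ c / 2 * m := by gcongr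
    have h8 : c / 2 * m ≤ (1 + M / κ) * f := by linarith
    calc m = 2 / c * (c / 2 * m) := by field_simp
      _ ≤ 2 / c * ((1 + M / κ) * f) := by gcongr
      _ = _ := by ring
  have h6 : k ≤ (W * κ)⁻¹ * (1 + W * M * ((1 + M / κ) * (2 / c))) * f := by
    rw [mul_assoc, le_inv_mul_iff₀ (by positivity)]
    refine h1.trans ?_
    have : W * M * m ≤ W * M * ((1 + M / κ) * (2 / c) * f) := by gcongr
    linarith
  linarith

/-- The equation `(T - w J) (k + m) = f`, with `k` in the kernel of `T` and `m` orthogonal to it: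
its inner product with `k` controls `k`, and the equation itself controls `T m`. -/
theorem norm_mul_le_of_pencil {V : Type*} [NormedAddCommGroup V] [InnerProductSpace ℂ V]
    {T J : V →L[ℂ] V} {κ : ℝ} {k m : V} (w : ℂ)
    (hTk : T k = 0) (hTm : ⟪k, T m⟫_ℂ = 0) (hκ : κ * ‖k‖ ^ 2 ≤ ‖⟪k, J k⟫_ℂ‖) :
    ‖w‖ * κ * ‖k‖ ≤ ‖(T - w • J) (k + m)‖ + ‖w‖ * ‖J‖ * ‖m‖ ∧
      ‖T m‖ ≤ ‖(T - w • J) (k + m)‖ + ‖w‖ * ‖J‖ * ‖m‖ + ‖w‖ * ‖J‖ * ‖k‖ := by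
  obtain ⟨f, hf⟩ : ∃ f, f = (T - w • J) (k + m) := ⟨_, rfl⟩
  have e : T m = f + w • J m + w • J k := by
    rw [hf, sub_apply, smul_apply, map_add, map_add, hTk, smul_add]; abel
  rw [← hf]
  constructor
  · have e' : w * ⟪k, J k⟫_ℂ = -⟪k, f⟫_ℂ - w * ⟪k, J m⟫_ℂ := by
      have := hTm
      rw [e, inner_add_right, inner_add_right, inner_smul_right, inner_smul_right] at this
      linear_combination this
    have h1 : ‖w‖ * ‖⟪k, J k⟫_ℂ‖ ≤ ‖k‖ * ‖f‖ + ‖w‖ * (‖k‖ * (‖J‖ * ‖m‖)) := by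
      rw [← norm_mul, e']
      refine (norm_sub_le _ _).trans ?_
      rw [norm_neg, norm_mul]
      refine add_le_add (norm_inner_le_norm _ _) (mul_le_mul_of_nonneg_left
        ((norm_inner_le_norm _ _).trans ?_) (norm_nonneg _))
      exact mul_le_mul_of_nonneg_left (J.le_opNorm m) (norm_nonneg _)
    rcases eq_or_ne k 0 with h0 | h0
    · rw [h0, norm_zero, mul_zero]; positivity
    · have hk0 : 0 < ‖k‖ := norm_pos_iff.2 h0
      have := mul_le_mul_of_nonneg_left hκ (norm_nonneg w)
      refine le_of_mul_le_mul_left ?_ hk0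
      linarith
  · rw [e]
    refine norm_add₃_le.trans ?_
    rw [norm_smul, norm_smul, mul_assoc, mul_assoc]
    exact add_le_add (add_le_add le_rfl (mul_le_mul_of_nonneg_left (J.le_opNorm m) (norm_nonneg _)))
      (mul_le_mul_of_nonneg_left (J.le_opNorm k) (norm_nonneg _))

/-- Zero is isolated in the spectrum of the pencil `T - w j† j`. -/
theorem exists_norm_le_of_pencil (hj : Function.Injective j) {T : V →L[ℂ] V}
    (hT : IsSelfAdjoint T) (hK : FiniteDimensional ℂ (LinearMap.ker T.toLinearMap))
    (hr : IsClosed (range T)) :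
    ∃ ε : ℝ, 0 < ε ∧ ∀ w : ℂ, 0 < ‖w‖ → ‖w‖ < ε →
      ∃ C : ℝ, ∀ u, ‖u‖ ≤ C * ‖(T - w • (ContinuousLinearMap.adjoint j ∘L j)) u‖ := by
  obtain ⟨c, hc, hcT⟩ := exists_norm_le_of_isClosed_range hr
  obtain ⟨κ, hκ, hκj⟩ := exists_mul_norm_sq_le hj (LinearMap.ker T.toLinearMap)
  obtain ⟨J, hJ⟩ : ∃ J, J = ContinuousLinearMap.adjoint j ∘L j := ⟨_, rfl⟩
  rw [← hJ]
  refine ⟨c / (2 * (‖J‖ + ‖J‖ ^ 2 / κ + 1)), by positivity, fun w hw hwε =>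
    ⟨(‖w‖ * κ)⁻¹ * (1 + ‖w‖ * ‖J‖ * ((1 + ‖J‖ / κ) * (2 / c))) + (1 + ‖J‖ / κ) * (2 / c),
      fun u => ?_⟩⟩
  obtain ⟨k, hk, m, hm, rfl⟩ := Submodule.mem_sup.1
    ((LinearMap.ker T.toLinearMap).sup_orthogonal_of_hasOrthogonalProjection ▸
      Submodule.mem_top : u ∈ LinearMap.ker T.toLinearMap ⊔ (LinearMap.ker T.toLinearMap)ᗮ)
  have hTk : T k = 0 := hk
  obtain ⟨h1, h2⟩ := norm_mul_le_of_pencil (T := T) (J := J) (κ := κ) (k := k) (m := m) w hTk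
    (by rw [← hT.inner_clm, hTk, inner_zero_left]) (by
      have e1 : ⟪k, J k⟫_ℂ = ⟪j k, j k⟫_ℂ := by
        rw [hJ, ContinuousLinearMap.comp_apply, ContinuousLinearMap.adjoint_inner_right]
      rw [e1, inner_self_eq_norm_sq_to_K]
      simpa using hκj k hk)
  have h0 : ‖w‖ * (‖J‖ + ‖J‖ ^ 2 / κ) ≤ c / 2 := by
    have hP : 0 ≤ ‖J‖ + ‖J‖ ^ 2 / κ := by positivity
    rw [lt_div_iff₀ (by positivity)] at hwε
    linarith
  have h3 := le_of_coupled_le hc hκ (norm_nonneg J) hw h0 (norm_nonneg m) h1 ((hcT m hm).trans h2)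
  exact (norm_add_le k m).trans h3

/-- The pencil is bounded below for small `w ≠ 0`, and so is its adjoint, which is the pencil at the
conjugate point; hence it is invertible. -/
theorem exists_isUnit_pencil (hj : Function.Injective j) {T : V →L[ℂ] V}
    (hT : IsSelfAdjoint T) (hK : FiniteDimensional ℂ (LinearMap.ker T.toLinearMap))
    (hr : IsClosed (range T)) :
    ∃ ε : ℝ, 0 < ε ∧ ∀ w : ℂ, 0 < ‖w‖ → ‖w‖ < ε →
      IsUnit (T - w • (ContinuousLinearMap.adjoint j ∘L j)) := by
  obtain ⟨ε, hε, h⟩ := exists_norm_le_of_pencil hj hT hK hr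
  refine ⟨ε, hε, fun w hw hwε => ?_⟩
  obtain ⟨C, hC⟩ := h w hw hwε
  obtain ⟨C', hC'⟩ := h (conj w) (by simpa using hw) (by simpa using hwε)
  rw [ContinuousLinearMap.isUnit_iff_bijective,
    ContinuousLinearMap.bijective_iff_dense_range_and_antilipschitz]
  constructor
  · rw [Submodule.topologicalClosure_eq_top_iff, ContinuousLinearMap.orthogonal_range, eq_bot_iff]
    intro u hu
    have e : ContinuousLinearMap.adjoint (T - w • (ContinuousLinearMap.adjoint j ∘L j)) =
        T - conj w • (ContinuousLinearMap.adjoint j ∘L j) := by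
      rw [map_sub, map_smulₛₗ, ContinuousLinearMap.adjoint_comp,
        ContinuousLinearMap.adjoint_adjoint, ← ContinuousLinearMap.star_eq_adjoint T, hT.star_eq]
    have h0 : (T - conj w • (ContinuousLinearMap.adjoint j ∘L j)) u = 0 := by
      rw [← e]; exact hu
    have := hC' u
    rw [h0, norm_zero, mul_zero] at this
    exact norm_le_zero_iff.1 this
  · refine ⟨⟨max C 0, le_max_right _ _⟩, AddMonoidHomClass.antilipschitz_of_bound _ fun u => ?_⟩
    exact (hC u).trans (mul_le_mul_of_nonneg_right (le_max_left _ _) (norm_nonneg _))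

/-- If `formOp j (B - c)` has a finite-dimensional kernel and a closed range, then `c` is not in the
essential spectrum. -/
theorem IsFormOperator.notMem_essSpec (hA : IsFormOperator j B A) (hj : Function.Injective j)
    (hB : IsSelfAdjoint B) {c : ℝ}
    (hK : FiniteDimensional ℂ (LinearMap.ker (formOp j (B - (c : ℂ) • 1)).toLinearMap))
    (hr : IsClosed (range (formOp j (B - (c : ℂ) • 1)))) : (c : ℂ) ∉ essSpec A := by
  rintro ⟨hs, hd⟩
  have hT := isSelfAdjoint_formOp (j := j) (isSelfAdjoint_sub_smul hB c)
  refine hd ⟨hs, ?_, ?_, ?_, ?_⟩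
  · obtain ⟨ε, hε, h⟩ := exists_isUnit_pencil hj hT hK hr
    rw [eventually_nhdsWithin_iff, Metric.eventually_nhds_iff]
    refine ⟨ε, hε, fun w hw hne => ?_⟩
    have := h (w - c) (norm_pos_iff.2 (sub_ne_zero.2 hne)) (by rwa [dist_eq_norm] at hw)
    rw [← formOp_sub_smul, sub_sub, ← add_smul, add_sub_cancel] at this
    exact not_not.2 (hA.mem_resolventSet this)
  · intro hbot
    refine hs (hA.mem_resolventSet ?_)
    have hker : LinearMap.ker (formOp j (B - (c : ℂ) • 1)).toLinearMap = ⊥ := by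
      rw [eq_bot_iff]
      intro u hu
      have : j u ∈ eigenspace A c := hA.mem_eigenspace.2 ⟨u, rfl, hu⟩
      rw [hbot, Submodule.mem_bot] at this
      exact (map_eq_zero_iff j hj).1 this
    rw [ContinuousLinearMap.isUnit_iff_bijective]
    refine ⟨LinearMap.ker_eq_bot.1 hker, ?_⟩
    have h1 : (LinearMap.range (formOp j (B - (c : ℂ) • 1)).toLinearMap)ᗮ = ⊥ := by
      rw [ContinuousLinearMap.orthogonal_range, ← ContinuousLinearMap.star_eq_adjoint, hT.star_eq,
        hker]
    rw [← Submodule.topologicalClosure_eq_top_iff] at h1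
    have h2 : IsClosed ((LinearMap.range (formOp j (B - (c : ℂ) • 1)).toLinearMap :
      Submodule ℂ V) : Set V) := hr
    rw [h2.submodule_topologicalClosure_eq] at h1
    exact LinearMap.range_eq_top.1 h1
  · have : rootSpace A c ≤ (LinearMap.ker (formOp j (B - (c : ℂ) • 1)).toLinearMap).map
        j.toLinearMap := by
      refine iSup_le fun k x hx => ?_
      obtain ⟨u, hu, h0⟩ := hA.mem_eigenspace.1 (hA.kerPow_le hB c k hx)
      exact ⟨u, h0, hu⟩
    exact Submodule.finiteDimensional_of_le this
  · rw [hA.range_shift]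
    exact hr.preimage (ContinuousLinearMap.continuous _)

theorem IsFormOperator.finiteDimensional_ker (hA : IsFormOperator j B A)
    (hj : Function.Injective j) {c : ℂ} (hK : FiniteDimensional ℂ (eigenspace A c)) :
    FiniteDimensional ℂ (LinearMap.ker (formOp j (B - c • 1)).toLinearMap) := by
  refine FiniteDimensional.of_injective (V₂ := eigenspace A c)
    ((j.toLinearMap.comp (Submodule.subtype _)).codRestrict _ fun u => ?_) ?_
  · exact hA.mem_eigenspace.2 ⟨u, rfl, u.2⟩
  · intro u v huv
    exact Subtype.ext (hj (congrArg Subtype.val huv))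

/-- The range of the form operator is the preimage of the range of the unbounded operator under a
bounded operator. -/
theorem IsFormOperator.isClosed_range (hA : IsFormOperator j B A) {c : ℂ}
    (hr : IsClosed (range fun x : A.domain => A x - c • (x : H))) :
    IsClosed (range (formOp j (B - c • 1))) := by
  -- a coercive shift of the form
  set z : ℂ := ((-‖B‖ : ℝ) : ℂ) with hz
  obtain ⟨e, he⟩ : IsUnit (formOp j (B - z • 1)) := by
    refine ContinuousLinearMap.isUnit_of_forall_le_norm_inner_map _ (c := 1) one_pos fun u => ?_
    have h1 := re_inner_formOp_sub_smul (j := j) (B := B) (-‖B‖) u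
    have h2 := re_inner_formOp_ge (j := j) (B := B) u
    have h3 : (⟪u, formOp j (B - z • 1) u⟫_ℂ).re ≤ ‖⟪formOp j (B - z • 1) u, u⟫_ℂ‖ := by
      rw [norm_inner_symm]; exact Complex.re_le_norm _
    simp only [NNReal.coe_one, mul_one]
    linarith
  have he1 : ∀ u, formOp j (B - z • 1) ((↑e⁻¹ : V →L[ℂ] V) u) = u := fun u => by
    rw [← he]; exact DFunLike.congr_fun e.mul_inv u
  rw [hA.range_shift] at hr
  have := hr.preimage (((c - z) • (j ∘L (↑e⁻¹ : V →L[ℂ] V))).continuous)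
  convert this using 1
  ext w
  set v := (↑e⁻¹ : V →L[ℂ] V) w with hv
  have hw : formOp j (B - c • 1) v = w - ContinuousLinearMap.adjoint j ((c - z) • j v) := by
    have h1 := he1 w
    rw [← hv, formOp_sub_smul_apply] at h1
    rw [formOp_sub_smul_apply, ← h1, sub_smul, map_sub]
    abel
  change w ∈ range _ ↔ ContinuousLinearMap.adjoint j ((c - z) • j v) ∈ range _
  constructor
  · rintro ⟨u, hu⟩
    exact ⟨u - v, by rw [map_sub, hu, hw]; abel⟩
  · rintro ⟨u, hu⟩
    exact ⟨u + v, by rw [map_add, hu, hw]; abel⟩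

theorem IsFormOperator.mem_essSpec (hA : IsFormOperator j B A) (hj : Function.Injective j)
    (hB : IsSelfAdjoint B) {c : ℝ} (h : minmaxSup j B = c) : (c : ℂ) ∈ essSpec A := by
  by_contra hc
  obtain ⟨h1, h2⟩ := finiteDimensional_eigenspace_isClosed_range hc
  exact not_finiteDimensional_ker_isClosed_range hj hB h
    ⟨hA.finiteDimensional_ker hj h1, hA.isClosed_range h2⟩

theorem neg_norm_le_minmaxSup (hj : Function.Injective j) :
    ((-‖B‖ : ℝ) : EReal) ≤ minmaxSup j B :=
  (neg_norm_le_minmax hj le_rfl).trans (minmax_le_minmaxSup le_rfl)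

/-- The infimum of the essential spectrum is the limit of the min-max numbers. -/
theorem IsFormOperator.iInf_essSpec (hA : IsFormOperator j B A) (hj : Function.Injective j)
    (hB : IsSelfAdjoint B) :
    ⨅ (r : ℝ) (_ : (r : ℂ) ∈ essSpec A), (r : EReal) = minmaxSup j B := by
  refine le_antisymm ?_ (le_iInf₂ fun r hr => ?_)
  · have h1 := neg_norm_le_minmaxSup (B := B) hj
    rcases eq_or_ne (minmaxSup j B) ⊤ with h | h
    · rw [h]; exact le_top
    · have h2 : minmaxSup j B = ((minmaxSup j B).toReal : ℝ) := by
        refine (EReal.coe_toReal h fun hb => ?_).symm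
        rw [hb, le_bot_iff] at h1
        exact EReal.coe_ne_bot _ h1
      rw [h2]
      exact iInf₂_le (f := fun (r : ℝ) (_ : (r : ℂ) ∈ essSpec A) => (r : EReal)) _
        (hA.mem_essSpec hj hB h2)
  · by_contra! hlt
    obtain ⟨n, -, hn⟩ := lt_minmaxSup_iff.1 hlt
    obtain ⟨h1, h2⟩ := finiteDimensional_ker_isClosed_range_of_lt_minmax hj hB hn
    exact hA.notMem_essSpec hj hB h1 h2 hr

end FormOperator

/-! ### Negative subspaces of a dense space -/

section Density

variable {V H : Type*} [NormedAddCommGroup V] [InnerProductSpace ℂ V]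
  [NormedAddCommGroup H] [InnerProductSpace ℂ H]

/-- A quadratic form which is negative definite on the span of `n` vectors is negative definite on
an `n`-dimensional subspace of any dense subspace: the negativity of the form on the unit sphere of
the coefficients is an open condition on the vectors. -/
theorem exists_submodule_inner_nonpos {j : V →L[ℂ] H} (hj : DenseRange j) (Q : H →L[ℂ] H) {n : ℕ}
    (f : Fin n → H)
    (hf : ∀ x : Fin n → ℂ, x ≠ 0 → (⟪∑ i, x i • f i, Q (∑ i, x i • f i)⟫_ℂ).re < 0) :
    ∃ L : Submodule ℂ V, Module.finrank ℂ L = n ∧ ∀ u ∈ L, (⟪j u, Q (j u)⟫_ℂ).re ≤ 0 := by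
  have hev : ∀ᶠ g in 𝓝 f, ∀ x ∈ Metric.sphere (0 : Fin n → ℂ) 1,
      (⟪∑ i, x i • g i, Q (∑ i, x i • g i)⟫_ℂ).re < 0 := by
    refine (isCompact_sphere _ _).eventually_forall_of_forall_eventually fun x hx => ?_
    have hc : Continuous fun p : (Fin n → H) × (Fin n → ℂ) =>
        (⟪∑ i, p.2 i • p.1 i, Q (∑ i, p.2 i • p.1 i)⟫_ℂ).re := by
      have h1 : Continuous fun p : (Fin n → H) × (Fin n → ℂ) => ∑ i, p.2 i • p.1 i := by fun_prop
      exact Complex.continuous_re.comp (h1.inner (Q.continuous.comp h1))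
    exact hc.continuousAt.eventually_lt continuousAt_const
      (hf x (Metric.ne_of_mem_sphere hx one_ne_zero))
  obtain ⟨g, hg⟩ := (DenseRange.piMap fun _ : Fin n => hj).mem_nhds hev
  have hneg : ∀ x : Fin n → ℂ, x ≠ 0 →
      (⟪∑ i, x i • j (g i), Q (∑ i, x i • j (g i))⟫_ℂ).re < 0 := by
    intro x hx
    have hx0 : 0 < ‖x‖ := norm_pos_iff.2 hx
    have h1 := hg (((‖x‖⁻¹ : ℝ) : ℂ) • x) (by
      rw [mem_sphere_zero_iff_norm, norm_smul, Complex.norm_real, norm_inv, norm_norm,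
        inv_mul_cancel₀ hx0.ne'])
    have e : ∑ i, (((‖x‖⁻¹ : ℝ) : ℂ) • x) i • Pi.map (fun _ => j) g i =
        ((‖x‖⁻¹ : ℝ) : ℂ) • ∑ i, x i • j (g i) := by
      rw [Finset.smul_sum]
      exact Finset.sum_congr rfl fun i _ => by simp [mul_smul]
    rw [e, map_smul, inner_smul_left, inner_smul_right, Complex.conj_ofReal,
      Complex.re_ofReal_mul, Complex.re_ofReal_mul] at h1
    have : 0 < ‖x‖⁻¹ := by positivity
    by_contra! hge
    exact absurd h1 (not_lt.2 (by positivity))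
  have hj' : ∀ x : Fin n → ℂ, j (∑ i, x i • g i) = ∑ i, x i • j (g i) := fun x => by
    simp
  refine ⟨LinearMap.range (Fintype.linearCombination ℂ g), ?_, ?_⟩
  · rw [LinearMap.finrank_range_of_inj, Module.finrank_fin_fun]
    rw [injective_iff_map_eq_zero]
    intro x hx
    by_contra hx0
    have := hneg x hx0
    rw [← hj', ← Fintype.linearCombination_apply, hx] at this
    simp at this
  · rintro _ ⟨x, rfl⟩
    rw [Fintype.linearCombination_apply, hj']
    rcases eq_or_ne x 0 with rfl | hx
    · simp
    · exact (hneg x hx).le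

end Density

/-! ### Disjoint sets of positive measure -/

section Splitting

variable {X : Type*} [TopologicalSpace X] [SecondCountableTopology X] [MeasurableSpace X]
  [BorelSpace X] {μ : Measure X} [μ.OuterRegular] [NullSingletonClass μ]

/-- A set of positive measure for a measure without atoms splits into two such sets, the first one of
finite measure: it is the intersection with a small neighbourhood of a point of density. -/
theorem exists_subset_measure_pos {E : Set X} (hE : MeasurableSet E)
    (h0 : μ E ≠ 0) : ∃ F ⊆ E, MeasurableSet F ∧ μ F ≠ 0 ∧ μ F ≠ (⊤ : ℝ≥0∞) ∧ μ (E \ F) ≠ 0 := by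
  obtain ⟨x, hx, hpos⟩ := exists_mem_forall_mem_nhdsWithin_pos_measure h0
  obtain ⟨U, hxU, hU, hlt⟩ := Set.exists_isOpen_lt_of_lt ({x} : Set X) (μ := μ) (μ E)
    (by rw [measure_singleton]; exact pos_iff_ne_zero.2 h0)
  have hle : μ (E ∩ U) ≤ μ U := measure_mono inter_subset_right
  refine ⟨E ∩ U, inter_subset_left, hE.inter hU.measurableSet, ?_, ?_, fun h => ?_⟩
  · exact (hpos _ (inter_mem self_mem_nhdsWithin
      (mem_nhdsWithin_of_mem_nhds (hU.mem_nhds (hxU rfl))))).ne'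
  · exact (hle.trans_lt (hlt.trans_le le_top)).ne
  · refine absurd hlt (not_lt.2 ?_)
    calc μ E ≤ μ (E ∩ U) + μ (E \ (E ∩ U)) := by
          rw [← measure_inter_add_sdiff E hU.measurableSet, sdiff_self_inter]
      _ ≤ μ U := by rw [h, add_zero]; exact hle

theorem exists_disjoint_measure_pos (n : ℕ) {E : Set X} (hE : MeasurableSet E) (h0 : μ E ≠ 0) :
    ∃ s : Fin n → Set X, (∀ i, MeasurableSet (s i) ∧ s i ⊆ E ∧ μ (s i) ≠ 0 ∧ μ (s i) ≠ (⊤ : ℝ≥0∞)) ∧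
      Pairwise fun i k => Disjoint (s i) (s k) := by
  induction n generalizing E with
  | zero => exact ⟨Fin.elim0, fun i => i.elim0, fun i => i.elim0⟩
  | succ n ih =>
    obtain ⟨F, hFE, hF, hF0, hFt, hEF⟩ := exists_subset_measure_pos hE h0
    obtain ⟨s, hs, hd⟩ := ih (hE.diff hF) hEF
    have hdF : ∀ i, Disjoint F (s i) := fun i =>
      disjoint_sdiff_right.mono_right (hs i).2.1
    refine ⟨Fin.cons F s, fun i => ?_, fun i k hik => ?_⟩
    · refine Fin.cases ?_ (fun i => ?_) i
      · exact ⟨hF, hFE, hF0, hFt⟩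
      · exact ⟨(hs i).1, (hs i).2.1.trans sdiff_subset, (hs i).2.2⟩
    · induction i using Fin.cases with
      | zero => induction k using Fin.cases with
        | zero => exact absurd rfl hik
        | succ k => exact hdF k
      | succ i => induction k using Fin.cases with
        | zero => exact (hdF i).symm
        | succ k => exact hd fun h => hik (congrArg Fin.succ h)

end Splitting

/-! ### The form domain and the multiplication by the damping -/

section Concrete

variable {d : ℕ} {Ω : Set (Space d)} {a b : Space d → ℝ}

theorem inner_formDomain (v u : FormDomain Ω b) : ⟪v, u⟫_ℂ =
    ⟪toL2 v, toL2 u⟫_ℂ + (⟪weakGrad v, weakGrad u⟫_ℂ + ⟪v.amb.snd.snd, u.amb.snd.snd⟫_ℂ) := by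
  change ⟪v.amb, u.amb⟫_ℂ = _
  rw [WithLp.prod_inner_apply, WithLp.prod_inner_apply]
  rfl

/-- The embedding of `D(s₀)` in `L²(Ω)`, as a bounded operator. -/
noncomputable def embed (Ω : Set (Space d)) (b : Space d → ℝ) : FormDomain Ω b →L[ℂ] L2 Ω :=
  LinearMap.mkContinuous
    { toFun := toL2
      map_add' := toL2_add
      map_smul' := toL2_smul } 1 fun u => by
    rw [one_mul]
    refine (sq_le_sq₀ (norm_nonneg _) (norm_nonneg _)).1 ?_
    rw [← re_inner_self u, inner_formDomain, Complex.add_re, Complex.add_re, re_inner_self,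
      re_inner_self, re_inner_self]
    change ‖toL2 u‖ ^ 2 ≤ _
    nlinarith [sq_nonneg ‖weakGrad u‖, sq_nonneg ‖u.amb.snd.snd‖]

theorem embed_apply (u : FormDomain Ω b) : embed Ω b u = toL2 u := rfl

theorem embed_injective (hΩ : IsOpen Ω) : Function.Injective (embed Ω b) := by
  rw [injective_iff_map_eq_zero]
  exact fun u hu => eq_zero_of_toL2 hΩ hu

theorem denseRange_embed (hΩ : IsOpen Ω) (h : H1 Ω a b) : DenseRange (embed Ω b) := by
  have h1 : (LinearMap.range (embed Ω b).toLinearMap)ᗮ = ⊥ := by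
    rw [eq_bot_iff]
    intro g hg
    refine (Lp.eq_zero_iff_ae_eq_zero).2 (eq_zero_of_test hΩ (Lp.memLp g) fun k h1 h2 h3 => ?_)
    obtain ⟨v, hv⟩ := exists_test h (isTest_ofReal h1 h2 h3)
    have key : ⟪toL2 v, g⟫_ℂ = 0 := hg _ ⟨v, rfl⟩
    rw [← key, L2.inner_def]
    refine integral_congr_ae ?_
    filter_upwards [hv] with x hx
    simp [hx, mul_comm]
  rw [← Submodule.topologicalClosure_eq_top_iff] at h1
  rw [DenseRange, dense_iff_closure_eq]
  exact congrArg (fun S : Submodule ℂ (L2 Ω) => (S : Set (L2 Ω))) h1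

/-- The multiplication by `a` in `L²(Ω)`. -/
noncomputable def mulOp (h : H1 Ω a b) : L2 Ω →L[ℂ] L2 Ω :=
  (ContinuousLinearMap.mul ℂ ℂ).holderL (volume.restrict Ω) ∞ 2 2
    (MemLp.toLp (fun x => (a x : ℂ)) h.a_bdd.ofReal)

theorem mulOp_ae (h : H1 Ω a b) (f : L2 Ω) :
    mulOp h f =ᵐ[volume.restrict Ω] fun x => (a x : ℂ) * f x := by
  have h1 := (ContinuousLinearMap.mul ℂ ℂ).coeFn_holder (r := 2)
    (MemLp.toLp (fun x => (a x : ℂ)) h.a_bdd.ofReal) f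
  have hm : MemLp (fun x => (a x : ℂ)) ∞ (volume.restrict Ω) := h.a_bdd.ofReal
  have h2 := hm.coeFn_toLp
  filter_upwards [h1, h2] with x e1 e2
  refine e1.trans ?_
  rw [e2]
  rfl

theorem inner_mulOp (h : H1 Ω a b) (f g : L2 Ω) :
    ⟪f, mulOp h g⟫_ℂ = ∫ x in Ω, (a x : ℂ) * (conj (f x) * g x) := by
  rw [L2.inner_def]
  refine integral_congr_ae ?_
  filter_upwards [mulOp_ae h g] with x hx
  rw [hx]
  simp only [RCLike.inner_apply]
  ring

theorem isSelfAdjoint_mulOp (h : H1 Ω a b) : IsSelfAdjoint (mulOp h) := by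
  rw [ContinuousLinearMap.isSelfAdjoint_iff_isSymmetric]
  intro f g
  change ⟪mulOp h f, g⟫_ℂ = ⟪f, mulOp h g⟫_ℂ
  rw [← inner_conj_symm, inner_mulOp, inner_mulOp, ← integral_conj]
  refine integral_congr_ae (.of_forall fun x => ?_)
  simp only [map_mul, Complex.conj_ofReal, Complex.conj_conj]
  ring

/-- The bounded operator `b_min - 1 + μ a` in `L²(Ω)`: the form `s_μ` is the inner product of
`D(s₀)` plus the form of this operator. -/
noncomputable def coefOp (h : H1 Ω a b) (μ : ℝ) : L2 Ω →L[ℂ] L2 Ω :=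
  ((essInf b (volume.restrict Ω) - 1 : ℝ) : ℂ) • 1 + (μ : ℂ) • mulOp h

theorem isSelfAdjoint_coefOp (h : H1 Ω a b) (μ : ℝ) : IsSelfAdjoint (coefOp h μ) :=
  (IsSelfAdjoint.smul (by simp [IsSelfAdjoint]) (.one _)).add
    (IsSelfAdjoint.smul (by simp [IsSelfAdjoint]) (isSelfAdjoint_mulOp h))

theorem form_eq_inner (h : H1 Ω a b) (μ : ℝ) (v u : FormDomain Ω b) :
    form a μ v u = ⟪v, formOp (embed Ω b) (coefOp h μ) u⟫_ℂ := by
  have i0 := integrable_conj_mul (toL2 v) (toL2 u)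
  have i1 := integrable_conj_mul v.amb.snd.snd u.amb.snd.snd
  have ia : IntegrableOn (fun x => (a x : ℂ) * (conj (toL2 v x) * toL2 u x)) Ω :=
    MemLp.integrable_mul (p := ∞) (q := 1) h.a_bdd.ofReal (memLp_one_iff_integrable.2 i0)
  have e0 : ∀ f g : L2 Ω, ⟪f, g⟫_ℂ = ∫ x in Ω, conj (f x) * g x := fun f g => by
    rw [L2.inner_def]
    exact integral_congr_ae (.of_forall fun x => by simp [mul_comm])
  have i2 : IntegrableOn (fun x => conj (v.amb.snd.snd x) * u.amb.snd.snd x +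
      ((essInf b (volume.restrict Ω) : ℝ) : ℂ) * (conj (toL2 v x) * toL2 u x)) Ω :=
    i1.add (i0.const_mul _)
  have key : ∫ x in Ω, conj (toL2 v x) * (((b x + μ * a x : ℝ) : ℂ) * toL2 u x) =
      ⟪v.amb.snd.snd, u.amb.snd.snd⟫_ℂ +
        ((essInf b (volume.restrict Ω) : ℝ) : ℂ) * ⟪toL2 v, toL2 u⟫_ℂ +
        (μ : ℂ) * ⟪toL2 v, mulOp h (toL2 u)⟫_ℂ := by
    rw [e0 v.amb.snd.snd, e0 (toL2 v) (toL2 u), inner_mulOp, ← integral_const_mul,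
      ← integral_const_mul,
      ← integral_add i1 (i0.const_mul _), ← integral_add i2 (ia.const_mul _)]
    refine integral_congr_ae ?_
    filter_upwards [weight_ae u, weight_ae v, weight_sq h] with x e1 e2 e3
    have e4 : (weight Ω b x : ℂ) * weight Ω b x =
        (b x : ℂ) - (essInf b (volume.restrict Ω) : ℝ) := by
      rw [← sq]; exact_mod_cast e3
    simp only [e1, e2, map_mul, Complex.conj_ofReal]
    push_cast
    linear_combination (-(conj (toL2 v x) * toL2 u x)) * e4
  rw [form, key, inner_formOp, inner_formDomain, embed_apply, embed_apply, coefOp]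
  simp only [add_apply, smul_apply, one_apply_eq_self, inner_add_right, inner_smul_right]
  push_cast
  ring

theorem rayleigh_eq_minmax (h : H1 Ω a b) (n : ℕ) (μ : ℝ) :
    rayleigh Ω a b n μ = minmax (embed Ω b) (coefOp h μ) n := by
  simp only [rayleigh, minmax, form_eq_inner h, embed_apply]

theorem isFormOperator_schrodinger (hΩ : IsOpen Ω) (h : H1 Ω a b) (μ : ℝ) :
    IsFormOperator (embed Ω b) (coefOp h μ) (schrodinger h μ) := by
  intro x f
  rw [schrodinger_graph h μ hΩ]
  refine exists_congr fun u => and_congr_right fun _ => ?_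
  constructor
  · intro hu
    refine ext_inner_left ℂ fun v => ?_
    rw [← form_eq_inner, hu v, ContinuousLinearMap.adjoint_inner_right, embed_apply]
  · intro hu v
    rw [form_eq_inner h, hu, ContinuousLinearMap.adjoint_inner_right, embed_apply]

theorem gammaInf_eq_minmaxSup (hΩ : IsOpen Ω) (h : H1 Ω a b) (μ : ℝ) :
    gammaInf h μ = minmaxSup (embed Ω b) (coefOp h μ) :=
  (isFormOperator_schrodinger hΩ h μ).iInf_essSpec (embed_injective hΩ) (isSelfAdjoint_coefOp h μ)

/-- If `σ a < -c'` on a set of positive measure, then `σ a` is at most `-c` in the mean on a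
subspace of the form domain of any prescribed dimension, for `c < c'`. -/
theorem exists_submodule_damping (hd : 1 ≤ d) (hΩ : IsOpen Ω) (h : H1 Ω a b) (σ : ℝ) {c c' : ℝ}
    (hcc : c < c') (hc' : volume.restrict Ω {x | c' < -(σ * a x)} ≠ 0) (n : ℕ) :
    ∃ L : Submodule ℂ (FormDomain Ω b), Module.finrank ℂ L = n ∧
      ∀ u ∈ L, σ * (⟪embed Ω b u, mulOp h (embed Ω b u)⟫_ℂ).re ≤ -c * ‖embed Ω b u‖ ^ 2 := by
  have : Nonempty (Fin d) := ⟨⟨0, hd⟩⟩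
  set a' := h.a_bdd.1.mk a with ha'
  have haa : a =ᵐ[volume.restrict Ω] a' := h.a_bdd.1.ae_eq_mk
  have ham : Measurable a' := h.a_bdd.1.stronglyMeasurable_mk.measurable
  set E : Set (Space d) := {x | c' < -(σ * a' x)} with hE
  have hEm : MeasurableSet E := measurableSet_lt measurable_const (ham.const_mul σ).neg
  have hE0 : volume.restrict Ω E ≠ 0 := by
    rw [← measure_congr (s := {x | c' < -(σ * a x)})]
    · exact hc'
    · filter_upwards [haa] with x hx
      simp only [hE, eq_iff_iff]
      change c' < -(σ * a x) ↔ c' < -(σ * a' x)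
      rw [hx]
  obtain ⟨s, hs, hdis⟩ := exists_disjoint_measure_pos n hEm hE0
  set f : Fin n → L2 Ω := fun i => indicatorConstLp 2 (hs i).1 (hs i).2.2.2 (1 : ℂ) with hf
  have hin : ∀ i k, ⟪f i, f k⟫_ℂ = (((volume.restrict Ω).real (s i ∩ s k) : ℝ) : ℂ) :=
    fun i k => L2.inner_indicatorConstLp_one_indicatorConstLp_one _ _ _ _
  have hli : LinearIndependent ℂ f := by
    refine linearIndependent_of_ne_zero_of_inner_eq_zero (𝕜 := ℂ) (fun i h0 => ?_)
      fun i k hik => ?_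
    · have := hin i i
      rw [h0, inner_zero_left, inter_self, eq_comm, Complex.ofReal_eq_zero,
        measureReal_eq_zero_iff (hs i).2.2.2] at this
      exact (hs i).2.2.1 this
    · change ⟪f i, f k⟫_ℂ = 0
      rw [hin, (hdis hik).inter_eq]
      simp
  obtain ⟨L, hL, hLneg⟩ := exists_submodule_inner_nonpos (denseRange_embed hΩ h)
    ((σ : ℂ) • mulOp h + (c : ℂ) • 1) f fun x hx => by
      set F := ∑ i, x i • f i with hF
      have hF0 : F ≠ 0 := fun h0 => hx (funext (Fintype.linearIndependent_iff.1 hli x h0))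
      have hsupp : ∀ᵐ y ∂volume.restrict Ω, F y ≠ 0 → y ∈ E := by
        have h1 : ∀ᵐ y ∂volume.restrict Ω, ∀ i, (x i • f i) y = x i * f i y :=
          ae_all_iff.2 fun i => Lp.coeFn_smul _ _
        have h2 : ∀ᵐ y ∂volume.restrict Ω, ∀ i, f i y = (s i).indicator (fun _ => 1) y :=
          ae_all_iff.2 fun i => indicatorConstLp_coeFn
        filter_upwards [Lp.coeFn_finsetSum Finset.univ (fun i => x i • f i), h1, h2]
          with y e1 e2 e3 hy
        rw [hF, e1, Finset.sum_apply] at hy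
        obtain ⟨i, -, hi⟩ := Finset.exists_ne_zero_of_sum_ne_zero hy
        rw [e2, e3] at hi
        exact (hs i).2.1 (mem_of_indicator_ne_zero (right_ne_zero_of_mul hi))
      have i0 := integrable_conj_mul F F
      have ia : IntegrableOn (fun x => (a x : ℂ) * (conj (F x) * F x)) Ω :=
        MemLp.integrable_mul (p := ∞) (q := 1) h.a_bdd.ofReal (memLp_one_iff_integrable.2 i0)
      have hre : ∀ y, conj (F y) * F y = ((‖F y‖ ^ 2 : ℝ) : ℂ) := fun y => by
        rw [Complex.conj_mul']; norm_cast
      have hle : σ * (⟪F, mulOp h F⟫_ℂ).re ≤ -c' * ‖F‖ ^ 2 := by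
        rw [← re_inner_self F, inner_mulOp, L2.inner_def]
        have e1 : ∫ y in Ω, (a y : ℂ) * (conj (F y) * F y) =
            ((∫ y in Ω, a y * ‖F y‖ ^ 2 : ℝ) : ℂ) := by
          rw [← integral_complex_ofReal]
          exact integral_congr_ae (.of_forall fun y => by simp only [hre]; push_cast; rfl)
        have e2 : ∫ y in Ω, ⟪F y, F y⟫_ℂ = ((∫ y in Ω, ‖F y‖ ^ 2 : ℝ) : ℂ) := by
          rw [← integral_complex_ofReal]
          refine integral_congr_ae (.of_forall fun y => ?_)
          simp only [← hre, RCLike.inner_apply]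
          ring
        have j1 : IntegrableOn (fun y => a y * ‖F y‖ ^ 2) Ω := by
          refine ia.re.congr (.of_forall fun y => ?_)
          simp only [hre]
          norm_cast
        have j0 : IntegrableOn (fun y => ‖F y‖ ^ 2) Ω := by
          refine i0.re.congr (.of_forall fun y => ?_)
          simp only [hre]
          norm_cast
        rw [e1, e2, Complex.ofReal_re, Complex.ofReal_re, ← integral_const_mul,
          ← integral_const_mul]
        refine integral_mono_ae (j1.const_mul _) (j0.const_mul _) ?_
        filter_upwards [hsupp, haa] with y h1 h2
        rcases eq_or_ne (F y) 0 with h0 | h0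
        · simp [h0]
        · have h3 : c' < -(σ * a' y) := h1 h0
          rw [← h2] at h3
          have : 0 < ‖F y‖ ^ 2 := by positivity
          nlinarith
      have hFp : 0 < ‖F‖ ^ 2 := by have := norm_pos_iff.2 hF0; positivity
      simp only [add_apply, smul_apply, one_apply_eq_self, inner_add_right, inner_smul_right,
        Complex.add_re, Complex.re_ofReal_mul, re_inner_self]
      nlinarith
  refine ⟨L, hL, fun u hu => ?_⟩
  have := hLneg u hu
  simp only [add_apply, smul_apply, one_apply_eq_self, inner_add_right, inner_smul_right,
    Complex.add_re, Complex.re_ofReal_mul, re_inner_self] at this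
  linarith

end Concrete

/-! ### The damped wave operator -/

section Wave

variable {d : ℕ} {Ω : Set (Space d)} {a b : Space d → ℝ}

/-- The operator in `D(s₀)` which represents the form of `S_{α t} + t²`. -/
noncomputable def waveFormOp (h : H1 Ω a b) (α t : ℝ) : FormDomain Ω b →L[ℂ] FormDomain Ω b :=
  formOp (embed Ω b) (coefOp h (α * t) - ((-t ^ 2 : ℝ) : ℂ) • 1)

theorem waveFormOp_apply (h : H1 Ω a b) (α t : ℝ) (u : FormDomain Ω b) :
    waveFormOp h α t u = formOp (embed Ω b) (coefOp h 0) u +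
      ContinuousLinearMap.adjoint (embed Ω b)
        (((α * t : ℝ) : ℂ) • mulOp h (toL2 u) + ((t ^ 2 : ℝ) : ℂ) • toL2 u) := by
  have e : coefOp h (α * t) - ((-t ^ 2 : ℝ) : ℂ) • 1 =
      coefOp h 0 + (((α * t : ℝ) : ℂ) • mulOp h + ((t ^ 2 : ℝ) : ℂ) • 1) := by
    simp only [coefOp]
    push_cast
    module
  rw [waveFormOp, e, formOp_add_apply]
  rfl

theorem mem_waveOp_graph (hΩ : IsOpen Ω) (h : H1 Ω a b) (α : ℝ) {p q : Energy Ω b} :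
    (p, q) ∈ (waveOp h α).graph ↔ toL2 q.fst = p.snd ∧
      formOp (embed Ω b) (coefOp h 0) p.fst = ContinuousLinearMap.adjoint (embed Ω b)
        (-q.snd - (α : ℂ) • mulOp h p.snd) := by
  have hS := isFormOperator_schrodinger hΩ h 0
  rw [waveOp_graph h α hΩ]
  change (toL2 q.fst = p.snd ∧ ∃ f : L2 Ω, (toL2 p.fst, f) ∈ (schrodinger h 0).graph ∧
      q.snd =ᵐ[volume.restrict Ω] fun x => -f x - ((α * a x : ℝ) : ℂ) * p.snd x) ↔ _
  refine and_congr_right fun _ => ?_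
  have hf : ∀ f : L2 Ω, (q.snd =ᵐ[volume.restrict Ω]
      fun x => -f x - ((α * a x : ℝ) : ℂ) * p.snd x) ↔ f = -q.snd - (α : ℂ) • mulOp h p.snd := by
    intro f
    rw [Lp.ext_iff]
    refine eventually_congr ?_
    filter_upwards [Lp.coeFn_sub (-q.snd) ((α : ℂ) • mulOp h p.snd), Lp.coeFn_neg q.snd,
      Lp.coeFn_smul (α : ℂ) (mulOp h p.snd), mulOp_ae h p.snd] with x e1 e2 e3 e4
    rw [e1, Pi.sub_apply, e2, e3, Pi.neg_apply, Pi.smul_apply, e4, smul_eq_mul]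
    push_cast
    constructor <;> intro h
    · linear_combination h
    · linear_combination h
  simp only [hf]
  constructor
  · rintro ⟨f, hg, rfl⟩
    obtain ⟨u, hu, hu'⟩ := (hS _ _).1 hg
    rwa [← embed_injective hΩ hu]
  · intro hu
    exact ⟨_, (hS _ _).2 ⟨p.fst, rfl, hu⟩, rfl⟩

/-- The resolvent equation of the damped wave operator at a real point, for a right-hand side whose
first component vanishes. -/
theorem mem_waveOp_graph_shift (hΩ : IsOpen Ω) (h : H1 Ω a b) (α t : ℝ) (g : L2 Ω)
    {p : Energy Ω b} :
    (p, WithLp.toLp 2 (0, -g) + (t : ℂ) • p) ∈ (waveOp h α).graph ↔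
      (t : ℂ) • toL2 p.fst = p.snd ∧
        waveFormOp h α t p.fst = ContinuousLinearMap.adjoint (embed Ω b) g := by
  rw [mem_waveOp_graph hΩ]
  have e1 : (WithLp.toLp 2 (0, -g) + (t : ℂ) • p : Energy Ω b).fst = (t : ℂ) • p.fst :=
    zero_add _
  have e2 : (WithLp.toLp 2 (0, -g) + (t : ℂ) • p : Energy Ω b).snd = -g + (t : ℂ) • p.snd := rfl
  rw [e1, e2, toL2_smul]
  refine and_congr_right fun hp => ?_
  rw [waveFormOp_apply, ← hp, ← eq_sub_iff_add_eq, ← map_sub, map_smul]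
  have e : -(-g + (t : ℂ) • (t : ℂ) • toL2 p.fst) - (α : ℂ) • (t : ℂ) • mulOp h (toL2 p.fst) =
      g - (((α * t : ℝ) : ℂ) • mulOp h (toL2 p.fst) + ((t ^ 2 : ℝ) : ℂ) • toL2 p.fst) := by
    push_cast
    module
  rw [e]

/-- The vectors `{0, -g}` in the range of `A_α - t` are those for which `g` is in the range of
`S_{α t} + t²`. -/
theorem isClosed_range_waveFormOp (hΩ : IsOpen Ω) (h : H1 Ω a b) (α t : ℝ)
    (hr : IsClosed (range fun x : (waveOp h α).domain => waveOp h α x - (t : ℂ) • (x : Energy Ω b))) :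
    IsClosed (range (waveFormOp h α t)) := by
  refine (isFormOperator_schrodinger hΩ h (α * t)).isClosed_range ?_
  rw [(isFormOperator_schrodinger hΩ h (α * t)).range_shift]
  have hc : Continuous fun g : L2 Ω => (WithLp.toLp 2 (0, -g) : Energy Ω b) :=
    (WithLp.prod_continuous_toLp 2 _ _).comp (continuous_const.prodMk continuous_neg)
  convert hr.preimage hc using 1
  ext g
  simp only [mem_preimage, mem_range_shift, mem_waveOp_graph_shift hΩ h]
  constructor
  · rintro ⟨u, hu⟩
    exact ⟨WithLp.toLp 2 (u, (t : ℂ) • toL2 u), rfl, hu⟩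
  · rintro ⟨p, -, hp⟩
    exact ⟨p.fst, hp⟩

/-- The linear map `ψ ↦ {ψ, t ψ}`. -/
noncomputable def diagonal (Ω : Set (Space d)) (b : Space d → ℝ) (t : ℝ) :
    FormDomain Ω b →ₗ[ℂ] Energy Ω b :=
  (WithLp.linearEquiv 2 ℂ (FormDomain Ω b × L2 Ω)).symm.toLinearMap ∘ₗ
    LinearMap.prod LinearMap.id ((t : ℂ) • (embed Ω b).toLinearMap)

theorem diagonal_injective (t : ℝ) : Function.Injective (diagonal Ω b t) := fun _ _ huv =>
  congrArg WithLp.fst huv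

theorem diagonal_mem_eigenspace (hΩ : IsOpen Ω) (h : H1 Ω a b) {α t : ℝ} {u : FormDomain Ω b}
    (hu : waveFormOp h α t u = 0) : diagonal Ω b t u ∈ eigenspace (waveOp h α) (t : ℂ) := by
  have h1 := (mem_waveOp_graph_shift hΩ h α t 0 (p := diagonal Ω b t u)).2
    ⟨rfl, by rw [map_zero]; exact hu⟩
  rw [mem_eigenspace]
  rwa [neg_zero, ← Prod.zero_eq_mk, WithLp.toLp_zero, zero_add] at h1

theorem exists_ker_to_eigenspace (hΩ : IsOpen Ω) (h : H1 Ω a b) (α t : ℝ) :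
    ∃ Φ : LinearMap.ker (waveFormOp h α t).toLinearMap →ₗ[ℂ] eigenspace (waveOp h α) (t : ℂ),
      Function.Injective Φ := by
  refine ⟨((diagonal Ω b t).comp (Submodule.subtype _)).codRestrict _ fun u =>
    diagonal_mem_eigenspace hΩ h u.2, fun u v huv => ?_⟩
  exact Subtype.ext (diagonal_injective t (congrArg Subtype.val huv))

theorem finrank_ker_le_multiplicity (hΩ : IsOpen Ω) (h : H1 Ω a b) (α t : ℝ)
    [FiniteDimensional ℂ (LinearMap.ker (waveFormOp h α t).toLinearMap)] :
    (Module.finrank ℂ (LinearMap.ker (waveFormOp h α t).toLinearMap) : ℕ∞) ≤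
      multiplicity (waveOp h α) (t : ℂ) := by
  obtain ⟨Φ, hΦ⟩ := exists_ker_to_eigenspace hΩ h α t
  have := LinearMap.rank_le_of_injective Φ hΦ
  rw [multiplicity, ← Cardinal.toENat_nat, Module.finrank_eq_rank]
  exact OrderHomClass.mono Cardinal.toENat this

/-- A point where `γ_∞` meets the parabola `c = -t²` belongs to the essential spectrum of `A_α`:
otherwise the form of `S_{α t}` would have a finite-dimensional kernel and a closed range there. -/
theorem mem_essSpec_waveOp (hΩ : IsOpen Ω) (h : H1 Ω a b) {α t : ℝ}
    (hc : minmaxSup (embed Ω b) (coefOp h (α * t)) = ((-t ^ 2 : ℝ) : EReal)) :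
    (t : ℂ) ∈ essSpec (waveOp h α) := by
  by_contra hn
  obtain ⟨h1, h2⟩ := finiteDimensional_eigenspace_isClosed_range hn
  obtain ⟨Φ, hΦ⟩ := exists_ker_to_eigenspace hΩ h α t
  exact not_finiteDimensional_ker_isClosed_range (embed_injective hΩ) (isSelfAdjoint_coefOp h _) hc
    ⟨FiniteDimensional.of_injective Φ hΦ,
      isClosed_range_waveFormOp hΩ h α t h2⟩

theorem card_le_multiplicity (hΩ : IsOpen Ω) (h : H1 Ω a b) {α t : ℝ}
    (hc : ((-t ^ 2 : ℝ) : EReal) < minmaxSup (embed Ω b) (coefOp h (α * t))) {s : Finset ℕ}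
    (hs : ∀ n ∈ s, minmax (embed Ω b) (coefOp h (α * t)) n = ((-t ^ 2 : ℝ) : EReal)) :
    (s.card : ℕ∞) ≤ multiplicity (waveOp h α) (t : ℂ) := by
  have hj := embed_injective (b := b) hΩ
  have hB := isSelfAdjoint_coefOp h (α * t)
  have : FiniteDimensional ℂ (LinearMap.ker (waveFormOp h α t).toLinearMap) :=
    (minmax_structure hj hB hc).1
  refine le_trans ?_ (finrank_ker_le_multiplicity hΩ h α t)
  exact_mod_cast card_minmax_eq_le hj hB hc hs

/-- A min-max number on the parabola `c = -t²` gives a point of the spectrum of `A_α`. -/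
theorem mem_spec_waveOp (hΩ : IsOpen Ω) (h : H1 Ω a b) {α t : ℝ} {n : ℕ} (hn : 1 ≤ n)
    (hc : minmax (embed Ω b) (coefOp h (α * t)) n = ((-t ^ 2 : ℝ) : EReal)) :
    (t : ℂ) ∈ spec (waveOp h α) := by
  rcases (minmax_le_minmaxSup (j := embed Ω b) (B := coefOp h (α * t)) hn).eq_or_lt with he | hlt
  · exact (mem_essSpec_waveOp hΩ h (he.symm.trans hc)).1
  · rw [hc] at hlt
    refine mem_spec_of_eigenspace_ne_bot fun hbot => ?_
    have := card_le_multiplicity hΩ h hlt (s := {n}) (by simpa using hc)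
    rw [multiplicity, hbot] at this
    simp at this

/-- The points at which the min-max numbers meet the parabola `c = -t²` below the essential
spectrum yield eigenvalues of `A_α`; a point is hit at most as often as its multiplicity. -/
theorem card_le_eigenvalueCount (hΩ : IsOpen Ω) (h : H1 Ω a b) {α : ℝ} {I : Set ℝ}
    {P : Finset (ℕ × ℝ)} (hP : ∀ p ∈ P, p.2 ∈ I ∧
      minmax (embed Ω b) (coefOp h (α * p.2)) p.1 = ((-p.2 ^ 2 : ℝ) : EReal) ∧
      ((-p.2 ^ 2 : ℝ) : EReal) < minmaxSup (embed Ω b) (coefOp h (α * p.2))) :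
    (P.card : ℕ∞) ≤ eigenvalueCount (waveOp h α) I := by
  classical
  have hI : ((P.image Prod.snd : Finset ℝ) : Set ℝ) ⊆ I := by
    intro t ht
    obtain ⟨p, hp, rfl⟩ := Finset.mem_image.1 ht
    exact (hP p hp).1
  refine le_trans ?_ (le_iSup₂ (f := fun (F : Finset ℝ) (_ : (F : Set ℝ) ⊆ I) =>
    ∑ r ∈ F, multiplicity (waveOp h α) (r : ℂ)) _ hI)
  rw [Finset.card_eq_sum_card_image Prod.snd P]
  push_cast
  refine Finset.sum_le_sum fun t ht => ?_
  obtain ⟨p, hp, rfl⟩ := Finset.mem_image.1 ht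
  rw [← Finset.card_image_of_injOn (f := Prod.fst)]
  · refine card_le_multiplicity hΩ h (hP p hp).2.2 fun n hn => ?_
    obtain ⟨q, hq, rfl⟩ := Finset.mem_image.1 hn
    obtain ⟨hq, hqp⟩ := Finset.mem_filter.1 hq
    rw [← hqp]
    exact (hP q hq).2.1
  · intro q hq r hr hqr
    have h1 := (Finset.mem_filter.1 hq).2
    have h2 := (Finset.mem_filter.1 hr).2
    exact Prod.ext hqr (h1.trans h2.symm)

end Wave

/-! ### Crossings of a curve and a parabola -/

section Crossing

/-- An extended real function which satisfies a Lipschitz condition is finite everywhere and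
continuous, as soon as it is finite at one point. -/
theorem exists_continuous_eq_coe {F : ℝ → EReal} {K : NNReal}
    (hF : ∀ s t r : ℝ, (r : EReal) < F t → ((r - K * |t - s| : ℝ) : EReal) ≤ F s)
    (hbot : ∀ t, F t ≠ ⊥) {t₀ : ℝ} (htop : F t₀ ≠ ⊤) :
    ∃ g : ℝ → ℝ, Continuous g ∧ ∀ t, F t = g t := by
  have hfin : ∀ t, F t = ((F t).toReal : ℝ) := by
    refine fun t => (EReal.coe_toReal (fun h => ?_) (hbot t)).symm
    have h0 := (EReal.coe_toReal htop (hbot t₀)).symm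
    have h1 := hF t₀ t ((F t₀).toReal + 1 + K * |t - t₀|) (by rw [h]; exact EReal.coe_lt_top _)
    rw [h0, EReal.coe_le_coe_iff, EReal.toReal_coe] at h1
    linarith
  refine ⟨fun t => (F t).toReal, ?_, hfin⟩
  refine (LipschitzWith.of_le_add_mul K fun t s => le_of_forall_lt fun r hr => ?_).continuous
  obtain ⟨r', h1, h2⟩ := exists_between hr
  have h3 := hF s t r' (by rw [hfin t]; exact EReal.coe_lt_coe_iff.2 h2)
  rw [hfin s, EReal.coe_le_coe_iff] at h3
  rw [Real.dist_eq]
  linarith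

/-- A curve with values in the extended reals which is finite and continuous, and decreases at most
linearly as its argument tends to `+∞`. -/
def TameCurve (F : ℝ → EReal) : Prop :=
  ∃ g : ℝ → ℝ, Continuous g ∧ (∀ t, F t = g t) ∧ ∃ C : ℝ, ∀ t, 0 ≤ t → -(C * (1 + t)) ≤ g t

variable {F : ℝ → EReal}

/-- A tame curve which is below the parabola at `τ₀` meets it beyond `τ₀`. -/
theorem TameCurve.exists_eq_right (hF : TameCurve F) {α τ₀ : ℝ} (hα : 0 < α) (hτ : 0 ≤ τ₀)
    (h : F τ₀ < ((-(τ₀ / α) ^ 2 : ℝ) : EReal)) :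
    ∃ τ, τ₀ < τ ∧ F τ = ((-(τ / α) ^ 2 : ℝ) : EReal) := by
  obtain ⟨g, hg, hFg, C, hC⟩ := hF
  rw [hFg, EReal.coe_lt_coe_iff] at h
  -- at `τ₁` the parabola is below `-C (1 + τ)`
  set τ₁ := τ₀ + 1 + 2 * |C| * α ^ 2 with hτ₁
  have h1 : 1 ≤ τ₁ := by
    have : 0 ≤ 2 * |C| * α ^ 2 := by positivity
    linarith
  have h2 : C * (1 + τ₁) < (τ₁ / α) ^ 2 := by
    rw [div_pow, lt_div_iff₀ (by positivity)]
    have h3 : C * (1 + τ₁) * α ^ 2 ≤ |C| * (2 * τ₁) * α ^ 2 := by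
      gcongr
      · exact le_abs_self C
      · linarith
    have h4 : 2 * |C| * α ^ 2 < τ₁ := by linarith
    nlinarith
  have hlt : τ₀ < τ₁ := by
    have : 0 ≤ 2 * |C| * α ^ 2 := by positivity
    linarith
  have hcont : ContinuousOn (fun τ => g τ + (τ / α) ^ 2) (Icc τ₀ τ₁) := by fun_prop
  obtain ⟨τ, hτm, hτ0⟩ := intermediate_value_Ioo hlt.le hcont (show (0 : ℝ) ∈ Ioo _ _ from
    ⟨by linarith, by linarith [hC τ₁ (by linarith)]⟩)
  refine ⟨τ, hτm.1, ?_⟩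
  rw [hFg, EReal.coe_eq_coe_iff]
  simp only at hτ0
  linarith

/-- A tame curve which is positive at `0` and below the parabola at `τ₀` meets it in between. -/
theorem TameCurve.exists_eq_left (hF : TameCurve F) {α τ₀ : ℝ} (hτ : 0 ≤ τ₀) (h0 : 0 < F 0)
    (h : F τ₀ < ((-(τ₀ / α) ^ 2 : ℝ) : EReal)) :
    ∃ τ, 0 < τ ∧ τ < τ₀ ∧ F τ = ((-(τ / α) ^ 2 : ℝ) : EReal) := by
  obtain ⟨g, hg, hFg, -⟩ := hF
  rw [hFg, EReal.coe_lt_coe_iff] at h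
  rw [hFg, ← EReal.coe_zero, EReal.coe_lt_coe_iff] at h0
  have hcont : ContinuousOn (fun τ => g τ + (τ / α) ^ 2) (Icc 0 τ₀) := by fun_prop
  obtain ⟨τ, hτm, hτ0⟩ := intermediate_value_Ioo' hτ hcont (show (0 : ℝ) ∈ Ioo _ _ from
    ⟨by linarith, by simpa using h0⟩)
  refine ⟨τ, hτm.1, hτm.2, ?_⟩
  rw [hFg, EReal.coe_eq_coe_iff]
  simp only at hτ0
  linarith

/-- The parabola gets flat as `α → ∞`. -/
theorem TameCurve.eventually_lt (hF : TameCurve F) {τ₀ : ℝ} (h : F τ₀ < 0) :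
    ∀ᶠ α : ℝ in atTop, F τ₀ < ((-(τ₀ / α) ^ 2 : ℝ) : EReal) := by
  obtain ⟨g, -, hFg, -⟩ := hF
  rw [hFg, ← EReal.coe_zero, EReal.coe_lt_coe_iff] at h
  have hlim : Tendsto (fun α : ℝ => -(τ₀ / α) ^ 2) atTop (𝓝 0) := by
    simpa using ((tendsto_const_nhds (x := τ₀)).div_atTop tendsto_id).pow 2 |>.neg
  filter_upwards [hlim.eventually (lt_mem_nhds h)] with α hα
  rw [hFg, EReal.coe_lt_coe_iff]
  exact hα

theorem exists_strictMono_thresholds {Q : ℕ → ℝ → Prop} (hQ : ∀ j, ∀ᶠ α in atTop, Q j α) :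
    ∃ s : ℕ → ℝ, StrictMono s ∧ (∀ j, 0 < s j) ∧ Tendsto s atTop atTop ∧
      ∀ j, ∀ α, s j ≤ α → Q j α := by
  choose T hT using fun j => eventually_atTop.1 (hQ j)
  set s : ℕ → ℝ := fun j => ∑ i ∈ Finset.range (j + 1), (|T i| + 1) with hs
  have hmono : StrictMono s := strictMono_nat_of_lt_succ fun j => by
    simp only [hs]
    rw [Finset.sum_range_succ _ (j + 1)]
    linarith [abs_nonneg (T (j + 1))]
  have hge : ∀ j : ℕ, (j : ℝ) + 1 ≤ s j := fun j => by
    calc (j : ℝ) + 1 = ∑ i ∈ Finset.range (j + 1), (1 : ℝ) := by simp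
      _ ≤ s j := Finset.sum_le_sum fun i _ => by linarith [abs_nonneg (T i)]
  refine ⟨s, hmono, fun j => ?_, ?_, fun j α hα => hT j α (le_trans ?_ hα)⟩
  · have : (0 : ℝ) ≤ j := by positivity
    linarith [hge j]
  · exact tendsto_atTop_mono (fun j => by linarith [hge j]) tendsto_natCast_atTop_atTop
  · calc T j ≤ |T j| + 1 := by linarith [le_abs_self (T j)]
      _ ≤ s j := Finset.single_le_sum (f := fun i => |T i| + 1) (fun i _ => by positivity)
        (Finset.self_mem_range_succ j)

end Crossing

/-! ### The min-max numbers as functions of the parameter -/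

section Perturbation

variable {V H : Type*} [NormedAddCommGroup V] [InnerProductSpace ℂ V] [CompleteSpace V]
  [NormedAddCommGroup H] [InnerProductSpace ℂ H] [CompleteSpace H]
  {j : V →L[ℂ] H} {B B' : H →L[ℂ] H}

theorem sub_le_minmax (hj : Function.Injective j) {D r : ℝ} (hD : ‖B' - B‖ ≤ D) {n : ℕ}
    (hr : r < minmax j B' n) : ((r - D : ℝ) : EReal) ≤ minmax j B n := by
  refine le_minmax hj fun L hL => ?_
  obtain ⟨u, hu, hu0, hlt⟩ := exists_lt_of_lt_minmax hj hr L hL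
  refine ⟨u, hu, hu0, ?_⟩
  have h1 : (⟪j u, (B' - B) (j u)⟫_ℂ).re ≤ D * ‖j u‖ ^ 2 := by
    refine (Complex.re_le_norm _).trans ((norm_inner_le_norm _ _).trans ?_)
    have := (B' - B).le_of_opNorm_le hD (j u)
    calc ‖j u‖ * ‖(B' - B) (j u)‖ ≤ ‖j u‖ * (D * ‖j u‖) := by gcongr
      _ = _ := by ring
  rw [sub_apply, inner_sub_right, Complex.sub_re] at h1
  rw [inner_formOp, Complex.add_re] at hlt ⊢
  linarith

theorem sub_le_minmaxSup (hj : Function.Injective j) {D r : ℝ} (hD : ‖B' - B‖ ≤ D)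
    (hr : r < minmaxSup j B') : ((r - D : ℝ) : EReal) ≤ minmaxSup j B := by
  obtain ⟨n, hn, hlt⟩ := lt_minmaxSup_iff.1 hr
  exact (sub_le_minmax hj hD hlt).trans (minmax_le_minmaxSup hn)

end Perturbation

section Curves

variable {d : ℕ} {Ω : Set (Space d)} {a b : Space d → ℝ}

/-- The min-max number `γ_n(σ τ)` of the Schrödinger operator `S_{σ τ}`. -/
noncomputable def gammaCurve (h : H1 Ω a b) (σ : ℝ) (n : ℕ) (τ : ℝ) : EReal :=
  minmax (embed Ω b) (coefOp h (σ * τ)) n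

/-- The infimum `γ_∞(σ τ)` of the essential spectrum of the Schrödinger operator `S_{σ τ}`. -/
noncomputable def gammaInfCurve (h : H1 Ω a b) (σ τ : ℝ) : EReal :=
  minmaxSup (embed Ω b) (coefOp h (σ * τ))

theorem norm_coefOp_sub_le (h : H1 Ω a b) (σ s t : ℝ) :
    ‖coefOp h (σ * t) - coefOp h (σ * s)‖ ≤ (‖σ‖₊ * ‖mulOp h‖₊ : NNReal) * |t - s| := by
  have e : coefOp h (σ * t) - coefOp h (σ * s) = ((σ * (t - s) : ℝ) : ℂ) • mulOp h := by
    simp only [coefOp]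
    push_cast
    module
  rw [e, norm_smul, Complex.norm_real, norm_mul, Real.norm_eq_abs (t - s)]
  push_cast
  exact le_of_eq (by ring)

theorem exists_norm_coefOp_le (h : H1 Ω a b) (σ : ℝ) :
    ∃ C : ℝ, ∀ t, 0 ≤ t → ‖coefOp h (σ * t)‖ ≤ C * (1 + t) := by
  refine ⟨‖coefOp h 0‖ + (‖σ‖₊ * ‖mulOp h‖₊ : NNReal), fun t ht => ?_⟩
  have h1 := norm_coefOp_sub_le h σ 0 t
  rw [mul_zero, sub_zero, abs_of_nonneg ht] at h1
  have h2 := norm_le_norm_add_norm_sub' (coefOp h (σ * t)) (coefOp h 0)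
  have h3 : 0 ≤ ‖coefOp h 0‖ * t := by positivity
  have h4 : (0 : ℝ) ≤ (‖σ‖₊ * ‖mulOp h‖₊ : NNReal) := NNReal.coe_nonneg _
  linarith

theorem tameCurve_of_perturbation (h : H1 Ω a b) (σ : ℝ) {F : ℝ → EReal}
    (hlow : ∀ t, ((-‖coefOp h (σ * t)‖ : ℝ) : EReal) ≤ F t)
    (hF : ∀ s t D r : ℝ, ‖coefOp h (σ * t) - coefOp h (σ * s)‖ ≤ D → (r : EReal) < F t →
      ((r - D : ℝ) : EReal) ≤ F s) {t₀ : ℝ} (htop : F t₀ ≠ ⊤) : TameCurve F := by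
  obtain ⟨g, hg, hFg⟩ := exists_continuous_eq_coe (K := ‖σ‖₊ * ‖mulOp h‖₊)
    (fun s t r hr => hF s t _ r (norm_coefOp_sub_le h σ s t) hr)
    (fun t hb => by
      have := hlow t
      rw [hb, le_bot_iff] at this
      exact EReal.coe_ne_bot _ this) htop
  obtain ⟨C, hC⟩ := exists_norm_coefOp_le h σ
  refine ⟨g, hg, hFg, C, fun t ht => ?_⟩
  have := hlow t
  rw [hFg, EReal.coe_le_coe_iff] at this
  linarith [hC t ht]

theorem tameCurve_gammaInfCurve (hΩ : IsOpen Ω) (h : H1 Ω a b) (σ : ℝ) {t₀ : ℝ}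
    (htop : gammaInfCurve h σ t₀ ≠ ⊤) : TameCurve (gammaInfCurve h σ) :=
  tameCurve_of_perturbation h σ (fun _ => neg_norm_le_minmaxSup (embed_injective hΩ))
    (fun _ _ _ _ hD hr => sub_le_minmaxSup (embed_injective hΩ) hD hr) htop

/-- The damping `σ a` has the mean value at most `-c` on subspaces of the form domain of any
dimension, for all `c < m`. -/
def HasDampingBelow (h : H1 Ω a b) (σ m : ℝ) : Prop :=
  ∀ c < m, ∀ n : ℕ, ∃ L : Submodule ℂ (FormDomain Ω b), Module.finrank ℂ L = n ∧
    ∀ u ∈ L, σ * (⟪embed Ω b u, mulOp h (embed Ω b u)⟫_ℂ).re ≤ -c * ‖embed Ω b u‖ ^ 2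

variable {h : H1 Ω a b} {σ m : ℝ}

/-- On a fixed subspace on which the damping is close to its bound, the form decreases linearly in
`τ`. -/
theorem HasDampingBelow.eventually_lt (hP : HasDampingBelow h σ m) (hΩ : IsOpen Ω) {c : ℝ}
    (hc : c < m) {n : ℕ} (hn : 1 ≤ n) :
    ∀ᶠ τ : ℝ in atTop, gammaCurve h σ n τ < ((-(c * τ) : ℝ) : EReal) := by
  obtain ⟨c', hcc', hc'm⟩ := exists_between hc
  obtain ⟨L, hL, hLle⟩ := hP c' hc'm n
  have : FiniteDimensional ℂ L := FiniteDimensional.of_finrank_pos (by omega)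
  obtain ⟨κ, hκ, hκL⟩ := exists_mul_norm_sq_le (embed_injective (b := b) hΩ) L
  set β := essInf b (volume.restrict Ω) - 1 with hβ
  filter_upwards [eventually_gt_atTop ((κ⁻¹ + β) / (c' - c)), eventually_ge_atTop 0] with τ h1 h0
  refine (minmax_le (embed_injective hΩ) hL (r := κ⁻¹ + β - c' * τ) fun u hu => ?_).trans_lt ?_
  · have h2 : ‖u‖ ^ 2 ≤ κ⁻¹ * ‖embed Ω b u‖ ^ 2 := by
      rw [le_inv_mul_iff₀ hκ]; exact hκL u hu
    rw [inner_formOp, coefOp, ← hβ]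
    simp only [add_apply, smul_apply, one_apply_eq_self, inner_add_right, inner_smul_right,
      Complex.add_re, Complex.re_ofReal_mul, re_inner_self]
    have h3 := mul_le_mul_of_nonneg_left (hLle u hu) h0
    linarith
  · rw [EReal.coe_lt_coe_iff]
    rw [div_lt_iff₀ (by linarith)] at h1
    linarith

theorem HasDampingBelow.tameCurve (hP : HasDampingBelow h σ m) (hΩ : IsOpen Ω) {n : ℕ}
    (hn : 1 ≤ n) : TameCurve (gammaCurve h σ n) := by
  obtain ⟨t₀, ht₀⟩ := (hP.eventually_lt hΩ (sub_one_lt m) hn).exists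
  exact tameCurve_of_perturbation h σ (fun _ => neg_norm_le_minmax (embed_injective hΩ) hn)
    (fun _ _ _ _ hD hr => sub_le_minmax (embed_injective hΩ) hD hr) ht₀.ne_top

theorem HasDampingBelow.exists_neg (hP : HasDampingBelow h σ m) (hΩ : IsOpen Ω) (hm : 0 < m)
    {n : ℕ} (hn : 1 ≤ n) : ∃ τ, 0 ≤ τ ∧ gammaCurve h σ n τ < 0 := by
  obtain ⟨τ, h1, h2⟩ := ((hP.eventually_lt hΩ hm hn).and (eventually_ge_atTop 0)).exists
  exact ⟨τ, h2, by simpa using h1⟩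

/-! ### The real spectrum of the damped wave operator on a half-line -/

/-- The substitution `t = σ τ / α`, with `σ = ±1`, which turns `S_{α t} + t²` into
`S_{σ τ} + (τ / α)²`. -/
theorem mul_div_cancel_sq (hσ : σ * σ = 1) {α : ℝ} (hα : 0 < α) (τ : ℝ) :
    α * (σ * τ / α) = σ * τ ∧ -(σ * τ / α) ^ 2 = -(τ / α) ^ 2 ∧ (0 < τ → 0 < σ * (σ * τ / α)) := by
  refine ⟨by field_simp, ?_, fun hτ => ?_⟩
  · rw [mul_div_assoc, mul_pow, sq σ, hσ, one_mul]
  · have : σ * (σ * τ / α) = τ / α := by rw [← mul_div_assoc, ← mul_assoc, hσ, one_mul]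
    rw [this]; positivity

theorem mem_essSpec_of_gammaInfCurve (hΩ : IsOpen Ω) (hσ : σ * σ = 1) {α τ : ℝ} (hα : 0 < α)
    (hτ : gammaInfCurve h σ τ = ((-(τ / α) ^ 2 : ℝ) : EReal)) :
    ((σ * τ / α : ℝ) : ℂ) ∈ essSpec (waveOp h α) := by
  obtain ⟨e1, e2, -⟩ := mul_div_cancel_sq hσ hα τ
  refine mem_essSpec_waveOp hΩ h ?_
  rw [e1, e2]
  exact hτ

theorem card_le_eigenvalueCount_of_gammaCurve (hΩ : IsOpen Ω) (hσ : σ * σ = 1) {α : ℝ} (hα : 0 < α)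
    {P : Finset (ℕ × ℝ)} (hP : ∀ p ∈ P, 0 < p.2 ∧
      gammaCurve h σ p.1 p.2 = ((-(p.2 / α) ^ 2 : ℝ) : EReal) ∧
      ((-(p.2 / α) ^ 2 : ℝ) : EReal) < gammaInfCurve h σ p.2) :
    (P.card : ℕ∞) ≤ eigenvalueCount (waveOp h α) {r | 0 < σ * r} := by
  classical
  have hσ0 : σ ≠ 0 := by rintro rfl; simp at hσ
  rw [← Finset.card_image_of_injective P (f := fun p : ℕ × ℝ => (p.1, σ * p.2 / α))]
  · refine card_le_eigenvalueCount hΩ h fun q hq => ?_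
    obtain ⟨p, hp, rfl⟩ := Finset.mem_image.1 hq
    obtain ⟨e1, e2, e3⟩ := mul_div_cancel_sq hσ hα p.2
    obtain ⟨h1, h2, h3⟩ := hP p hp
    refine ⟨e3 h1, ?_⟩
    simp only [e1, e2]
    exact ⟨h2, h3⟩
  · rintro ⟨n, s⟩ ⟨k, t⟩ hst
    simp only [Prod.mk.injEq] at hst ⊢
    refine ⟨hst.1, ?_⟩
    have := hst.2
    field_simp at this
    exact this

theorem HasDampingBelow.eventually_spec (hP : HasDampingBelow h σ m) (hΩ : IsOpen Ω) (hm : 0 < m)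
    (hσ : σ * σ = 1) :
    ∀ᶠ α : ℝ in atTop, ∃ r : ℝ, 0 < σ * r ∧ (r : ℂ) ∈ spec (waveOp h α) := by
  have hT := hP.tameCurve hΩ le_rfl
  obtain ⟨τ₀, h0, hneg⟩ := hP.exists_neg hΩ hm le_rfl
  filter_upwards [hT.eventually_lt hneg, eventually_gt_atTop 0] with α h1 hα
  obtain ⟨τ, hτ, hτe⟩ := hT.exists_eq_right hα h0 h1
  obtain ⟨e1, e2, e3⟩ := mul_div_cancel_sq hσ hα τ
  refine ⟨_, e3 (h0.trans_lt hτ), mem_spec_waveOp hΩ h le_rfl ?_⟩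
  rw [e1, e2]
  exact hτe

/-- If `γ_∞` decreases more slowly than the `γ_n`, each of the curves `γ_1, …, γ_j` crosses the
parabola in the region where it is below `γ_∞`, for large `α`. -/
theorem HasDampingBelow.exists_thresholds_of_slope (hP : HasDampingBelow h σ m) (hΩ : IsOpen Ω)
    (hm : 0 < m) (hσ : σ * σ = 1) {c : ℝ} (hc : c < m)
    (hslope : ∀ᶠ τ : ℝ in atTop, ((-(c * τ) : ℝ) : EReal) < gammaInfCurve h σ τ) :
    ∃ s : ℕ → ℝ, StrictMono s ∧ (∀ j, 0 < s j) ∧ Tendsto s atTop atTop ∧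
      ∀ j, ∀ α, s j ≤ α → (j : ℕ∞) ≤ eigenvalueCount (waveOp h α) {r | 0 < σ * r} := by
  classical
  refine exists_strictMono_thresholds fun j => ?_
  have key : ∀ n ∈ Finset.Icc 1 j, ∀ᶠ α : ℝ in atTop, ∃ τ, 0 < τ ∧
      gammaCurve h σ n τ = ((-(τ / α) ^ 2 : ℝ) : EReal) ∧
      ((-(τ / α) ^ 2 : ℝ) : EReal) < gammaInfCurve h σ τ := by
    intro n hn
    have hn1 := (Finset.mem_Icc.1 hn).1
    have hT := hP.tameCurve hΩ hn1
    have hev := (hP.eventually_lt hΩ hc hn1).and hslope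
    obtain ⟨T, hTev⟩ := eventually_atTop.1 hev
    obtain ⟨τ₀, hneg, hτ₀⟩ := ((hP.eventually_lt hΩ hm hn1).and
      (eventually_ge_atTop (max T 0))).exists
    rw [zero_mul, neg_zero, EReal.coe_zero] at hneg
    filter_upwards [hT.eventually_lt hneg, eventually_gt_atTop 0] with α h1 hα
    obtain ⟨τ, hτ, hτe⟩ := hT.exists_eq_right hα ((le_max_right T 0).trans hτ₀) h1
    obtain ⟨h2, h3⟩ := hTev τ (((le_max_left T 0).trans hτ₀).trans hτ.le)
    exact ⟨τ, ((le_max_right T 0).trans hτ₀).trans_lt hτ, hτe, hτe ▸ h2.trans h3⟩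
  filter_upwards [(Finset.eventually_all _).2 key, eventually_gt_atTop 0] with α hall hα
  choose! t ht using hall
  have hcard : ((Finset.Icc 1 j).image fun n => (n, t n)).card = j := by
    rw [Finset.card_image_of_injective _ fun x y hxy => congrArg Prod.fst hxy]
    simp
  rw [← hcard]
  refine card_le_eigenvalueCount_of_gammaCurve hΩ hσ hα fun p hp => ?_
  obtain ⟨n, hn, rfl⟩ := Finset.mem_image.1 hp
  exact ht n hn

/-- If `γ_∞` is positive, all the crossings with the parabola are below `γ_∞`. A curve which starts
below zero has one crossing for every `α > 0`, and a curve which starts above zero has two for large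
`α`; curves which start at zero are not used. -/
theorem HasDampingBelow.exists_thresholds_of_pos (hP : HasDampingBelow h σ m) (hΩ : IsOpen Ω)
    (hm : 0 < m) (hσ : σ * σ = 1) (hpos : ∀ τ, 0 ≤ τ → 0 < gammaInfCurve h σ τ) :
    (∀ α, 0 < α → negCount h 0 ≤ eigenvalueCount (waveOp h α) {r | 0 < σ * r}) ∧
    ∃ s : ℕ → ℝ, StrictMono s ∧ (∀ j, 0 < s j) ∧ Tendsto s atTop atTop ∧
      ∀ j, ∀ α, s j ≤ α →
        2 * (j : ℕ∞) + negCount h 0 ≤ eigenvalueCount (waveOp h α) {r | 0 < σ * r} := by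
  classical
  have h0 := hpos 0 le_rfl
  have hB := isSelfAdjoint_coefOp h (σ * 0)
  have hpar : ∀ {α τ : ℝ}, 0 ≤ τ → ((-(τ / α) ^ 2 : ℝ) : EReal) < gammaInfCurve h σ τ :=
    fun hτ => lt_of_le_of_lt (by
      rw [← EReal.coe_zero, EReal.coe_le_coe_iff]
      exact neg_nonpos.2 (sq_nonneg _)) (hpos _ hτ)
  -- all but finitely many of the numbers `γ_n(0)` are positive
  obtain ⟨M, hM⟩ : ∃ M : ℕ, ∀ n, M < n → 0 < gammaCurve h σ n 0 := by
    have h0' : ((0 : ℝ) : EReal) < minmaxSup (embed Ω b) (coefOp h (σ * 0)) := by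
      rw [EReal.coe_zero]; exact h0
    obtain ⟨M, hM⟩ := exists_forall_lt_minmax (embed_injective hΩ) hB h0'
    refine ⟨M, fun n hn => ?_⟩
    have h3 := hM n hn
    rw [EReal.coe_zero] at h3
    exact h3
  set I := (Finset.Icc 1 M).filter fun n => gammaCurve h σ n 0 < 0 with hI
  have hcount : negCount h 0 = (I.card : ℕ∞) := by
    rw [negCount, ← Set.encard_coe_eq_coe_finsetCard]
    congr 1
    ext n
    have e1 : gammaInf h 0 = gammaInfCurve h σ 0 := by
      rw [gammaInf_eq_minmaxSup hΩ, gammaInfCurve, mul_zero]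
    have e2 : rayleigh Ω a b n 0 = gammaCurve h σ n 0 := by
      rw [rayleigh_eq_minmax h, gammaCurve, mul_zero]
    rw [hI, Finset.coe_filter]
    simp only [mem_ofPred_eq, Finset.mem_Icc, e1, e2, min_eq_left h0.le]
    constructor
    · rintro ⟨h1, h2⟩
      exact ⟨⟨h1, not_lt.1 fun hlt => absurd (hM n hlt) (not_lt.2 h2.le)⟩, h2⟩
    · rintro ⟨⟨h1, -⟩, h2⟩
      exact ⟨h1, h2⟩
  have keyI : ∀ α, 0 < α → ∀ n ∈ I, ∃ τ, 0 < τ ∧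
      gammaCurve h σ n τ = ((-(τ / α) ^ 2 : ℝ) : EReal) := by
    intro α hα n hn
    obtain ⟨h1, h2⟩ := Finset.mem_filter.1 hn
    exact (hP.tameCurve hΩ (Finset.mem_Icc.1 h1).1).exists_eq_right hα le_rfl (by simpa using h2)
  refine ⟨fun α hα => ?_, exists_strictMono_thresholds fun j => ?_⟩
  · choose! t ht using keyI α hα
    rw [hcount, ← Finset.card_image_of_injective I (f := fun n => (n, t n))
      fun x y hxy => congrArg Prod.fst hxy]
    refine card_le_eigenvalueCount_of_gammaCurve hΩ hσ hα fun p hp => ?_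
    obtain ⟨n, hn, rfl⟩ := Finset.mem_image.1 hp
    exact ⟨(ht n hn).1, (ht n hn).2, hpar (ht n hn).1.le⟩
  · -- each of `j` curves which start above zero crosses the parabola twice
    set J := Finset.Ioc M (M + j) with hJ
    have keyJ : ∀ n ∈ J, ∀ᶠ α : ℝ in atTop, ∃ τ τ', 0 < τ ∧ τ < τ' ∧
        gammaCurve h σ n τ = ((-(τ / α) ^ 2 : ℝ) : EReal) ∧
        gammaCurve h σ n τ' = ((-(τ' / α) ^ 2 : ℝ) : EReal) := by
      intro n hn
      have hMn := (Finset.mem_Ioc.1 hn).1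
      have hT := hP.tameCurve hΩ (n := n) (by omega)
      obtain ⟨τ₀, hτ₀, hneg⟩ := hP.exists_neg hΩ hm (n := n) (by omega)
      filter_upwards [hT.eventually_lt hneg, eventually_gt_atTop 0] with α h1 hα
      obtain ⟨τ, h2, h3, h4⟩ := hT.exists_eq_left hτ₀ (hM n hMn) h1
      obtain ⟨τ', h5, h6⟩ := hT.exists_eq_right hα hτ₀ h1
      exact ⟨τ, τ', h2, h3.trans h5, h4, h6⟩
    filter_upwards [(Finset.eventually_all _).2 keyJ, eventually_gt_atTop 0] with α hall hα
    choose! t ht using keyI α hα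
    choose! s s' hs using hall
    have hinj : ∀ f : ℕ → ℝ, Function.Injective fun n => (n, f n) :=
      fun f x y hxy => congrArg Prod.fst hxy
    have hdIJ : ∀ n ∈ I, n ∉ J := by
      intro n hn hn'
      have h1 := (Finset.mem_Icc.1 (Finset.mem_filter.1 hn).1).2
      have h2 := (Finset.mem_Ioc.1 hn').1
      omega
    have hd1 : Disjoint (J.image fun n => (n, s n)) (J.image fun n => (n, s' n)) := by
      rw [Finset.disjoint_left]
      rintro _ h1 h2
      obtain ⟨n, hn, rfl⟩ := Finset.mem_image.1 h1
      obtain ⟨k, -, hk⟩ := Finset.mem_image.1 h2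
      obtain ⟨rfl, hk2⟩ := Prod.mk.inj hk
      exact (hs k hn).2.1.ne' hk2
    have hd2 : Disjoint ((J.image fun n => (n, s n)) ∪ (J.image fun n => (n, s' n)))
        (I.image fun n => (n, t n)) := by
      rw [Finset.disjoint_left]
      rintro _ h1 h2
      obtain ⟨n, hn, rfl⟩ := Finset.mem_image.1 h2
      rcases Finset.mem_union.1 h1 with h1 | h1 <;>
      · obtain ⟨k, hk, hkn⟩ := Finset.mem_image.1 h1
        obtain ⟨rfl, -⟩ := Prod.mk.inj hkn
        exact hdIJ k hn hk
    have hcard : (((J.image fun n => (n, s n)) ∪ (J.image fun n => (n, s' n))) ∪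
        (I.image fun n => (n, t n))).card = 2 * j + I.card := by
      rw [Finset.card_union_of_disjoint hd2, Finset.card_union_of_disjoint hd1,
        Finset.card_image_of_injective _ (hinj s), Finset.card_image_of_injective _ (hinj s'),
        Finset.card_image_of_injective _ (hinj t), hJ, Nat.card_Ioc]
      omega
    have e : 2 * (j : ℕ∞) + negCount h 0 = ((2 * j + I.card : ℕ) : ℕ∞) := by
      rw [hcount]; push_cast; rfl
    rw [e, ← hcard]
    refine card_le_eigenvalueCount_of_gammaCurve hΩ hσ hα fun p hp => ?_
    rcases Finset.mem_union.1 hp with hp | hp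
    · rcases Finset.mem_union.1 hp with hp | hp
      · obtain ⟨n, hn, rfl⟩ := Finset.mem_image.1 hp
        obtain ⟨h1, h2, h3, h4⟩ := hs n hn
        exact ⟨h1, h3, hpar h1.le⟩
      · obtain ⟨n, hn, rfl⟩ := Finset.mem_image.1 hp
        obtain ⟨h1, h2, h3, h4⟩ := hs n hn
        exact ⟨h1.trans h2, h4, hpar (h1.trans h2).le⟩
    · obtain ⟨n, hn, rfl⟩ := Finset.mem_image.1 hp
      exact ⟨(ht n hn).1, (ht n hn).2, hpar (ht n hn).1.le⟩

theorem eventually_essSpec (hΩ : IsOpen Ω) (hσ : σ * σ = 1) {τ₀ : ℝ} (hτ₀ : 0 ≤ τ₀)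
    (hneg : gammaInfCurve h σ τ₀ < 0) :
    ∀ᶠ α : ℝ in atTop, ∃ r : ℝ, 0 < σ * r ∧ (r : ℂ) ∈ essSpec (waveOp h α) := by
  have hT := tameCurve_gammaInfCurve hΩ h σ hneg.ne_top
  filter_upwards [hT.eventually_lt hneg, eventually_gt_atTop 0] with α h1 hα
  obtain ⟨τ, hτ, hτe⟩ := hT.exists_eq_right hα hτ₀ h1
  exact ⟨_, (mul_div_cancel_sq hσ hα τ).2.2 (hτ₀.trans_lt hτ),
    mem_essSpec_of_gammaInfCurve hΩ hσ hα hτe⟩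

theorem eventually_essSpec_two (hΩ : IsOpen Ω) (hσ : σ * σ = 1) {τ₀ : ℝ} (hτ₀ : 0 ≤ τ₀)
    (hpos : 0 < gammaInfCurve h σ 0) (hneg : gammaInfCurve h σ τ₀ < 0) :
    ∀ᶠ α : ℝ in atTop, ∃ r r' : ℝ, 0 < σ * r ∧ 0 < σ * r' ∧ r ≠ r' ∧
      (r : ℂ) ∈ essSpec (waveOp h α) ∧ (r' : ℂ) ∈ essSpec (waveOp h α) := by
  have hT := tameCurve_gammaInfCurve hΩ h σ hneg.ne_top
  have hσ0 : σ ≠ 0 := by rintro rfl; simp at hσ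
  filter_upwards [hT.eventually_lt hneg, eventually_gt_atTop 0] with α h1 hα
  obtain ⟨τ, h2, h3, h4⟩ := hT.exists_eq_left hτ₀ hpos h1
  obtain ⟨τ', h5, h6⟩ := hT.exists_eq_right hα hτ₀ h1
  refine ⟨_, _, (mul_div_cancel_sq hσ hα τ).2.2 h2,
    (mul_div_cancel_sq hσ hα τ').2.2 (hτ₀.trans_lt h5), fun he => ?_,
    mem_essSpec_of_gammaInfCurve hΩ hσ hα h4, mem_essSpec_of_gammaInfCurve hΩ hσ hα h6⟩
  field_simp at he
  exact (h3.trans h5).ne he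

/-! ### The slope of `γ_∞` and the essential bounds of the damping -/

theorem gammaInf_eq_gammaInfCurve (hΩ : IsOpen Ω) (h : H1 Ω a b) (hσ : σ * σ = 1) (μ : ℝ) :
    gammaInf h μ = gammaInfCurve h σ (σ * μ) := by
  rw [gammaInf_eq_minmaxSup hΩ, gammaInfCurve, ← mul_assoc, hσ, one_mul]

theorem gammaInf_ne_bot (hΩ : IsOpen Ω) (h : H1 Ω a b) (μ : ℝ) : gammaInf h μ ≠ ⊥ := fun hb => by
  have := neg_norm_le_minmaxSup (B := coefOp h μ) (embed_injective (b := b) hΩ)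
  rw [← gammaInf_eq_minmaxSup hΩ, hb, le_bot_iff] at this
  exact EReal.coe_ne_bot _ this

theorem coe_mul_lt_of_div_lt {x : EReal} (hx : x ≠ ⊥) {μ c : ℝ} (hμ : μ < 0)
    (h : x / (μ : EReal) < c) : ((c * μ : ℝ) : EReal) < x := by
  induction x with
  | bot => exact absurd rfl hx
  | top => exact EReal.coe_lt_top _
  | coe x =>
    rw [← EReal.coe_div, EReal.coe_lt_coe_iff, div_lt_iff_of_neg hμ] at h
    rw [EReal.coe_lt_coe_iff]
    exact h

theorem coe_mul_lt_of_lt_div {x : EReal} (hx : x ≠ ⊥) {μ c : ℝ} (hμ : 0 < μ)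
    (h : (c : EReal) < x / (μ : EReal)) : ((c * μ : ℝ) : EReal) < x := by
  induction x with
  | bot => exact absurd rfl hx
  | top => exact EReal.coe_lt_top _
  | coe x =>
    rw [← EReal.coe_div, EReal.coe_lt_coe_iff, lt_div_iff₀ hμ] at h
    rw [EReal.coe_lt_coe_iff]
    exact h

theorem exists_slope_atBot (hΩ : IsOpen Ω) {l : EReal}
    (hl : Tendsto (fun μ : ℝ => gammaInf h μ / (μ : EReal)) atBot (𝓝 l)) (hlm : l < m) :
    ∃ c < m, ∀ᶠ τ : ℝ in atTop, ((-(c * τ) : ℝ) : EReal) < gammaInfCurve h (-1) τ := by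
  obtain ⟨c, h1, h2⟩ := EReal.lt_iff_exists_real_btwn.1 hlm
  refine ⟨c, EReal.coe_lt_coe_iff.1 h2, ?_⟩
  have hev := (hl.eventually (gt_mem_nhds h1)).and (eventually_lt_atBot 0)
  filter_upwards [tendsto_neg_atTop_atBot.eventually hev] with τ hτ
  have := coe_mul_lt_of_div_lt (gammaInf_ne_bot hΩ h _) hτ.2 hτ.1
  rwa [gammaInf_eq_gammaInfCurve hΩ h (σ := -1) (by norm_num), neg_one_mul, neg_neg,
    mul_neg] at this

theorem exists_slope_atTop (hΩ : IsOpen Ω) {l : EReal}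
    (hl : Tendsto (fun μ : ℝ => gammaInf h μ / (μ : EReal)) atTop (𝓝 l))
    (hlm : ((-m : ℝ) : EReal) < l) :
    ∃ c < m, ∀ᶠ τ : ℝ in atTop, ((-(c * τ) : ℝ) : EReal) < gammaInfCurve h 1 τ := by
  obtain ⟨c, h1, h2⟩ := EReal.lt_iff_exists_real_btwn.1 hlm
  refine ⟨-c, by linarith [EReal.coe_lt_coe_iff.1 h1], ?_⟩
  filter_upwards [hl.eventually (lt_mem_nhds h2), eventually_gt_atTop 0] with τ hτ h0
  have := coe_mul_lt_of_lt_div (gammaInf_ne_bot hΩ h _) h0 hτ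
  rwa [gammaInf_eq_gammaInfCurve hΩ h (σ := 1) (by norm_num), one_mul, ← neg_neg (c * τ),
    ← neg_mul] at this

theorem exists_abs_le (h : H1 Ω a b) : ∃ M : ℝ, ∀ᵐ x ∂volume.restrict Ω, |a x| ≤ M := by
  have hb := h.a_bdd.eLpNorm_lt_top
  rw [eLpNorm_exponent_top] at hb
  obtain ⟨M, hM⟩ := eLpNormEssSup_lt_top_iff_isBoundedUnder.1 hb
  exact ⟨M, by simpa [← NNReal.coe_le_coe] using hM⟩

theorem hasDampingBelow_essSup (hd : 1 ≤ d) (hΩ : IsOpen Ω) (hne : Ω.Nonempty) (h : H1 Ω a b) :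
    HasDampingBelow h (-1) (essSup a (volume.restrict Ω)) := by
  intro c hc n
  obtain ⟨c', h1, h2⟩ := exists_between hc
  refine exists_submodule_damping hd hΩ h (-1) h1 (fun h0 => ?_) n
  obtain ⟨M, hM⟩ := exists_abs_le h
  have : NeBot (ae (volume.restrict Ω)) := by
    rw [ae_neBot, Ne, Measure.restrict_eq_zero]
    exact (hΩ.measure_pos volume hne).ne'
  have hco : IsCoboundedUnder (· ≤ ·) (ae (volume.restrict Ω)) a :=
    IsBoundedUnder.isCoboundedUnder_le ⟨-M, by
      rw [eventually_map]
      filter_upwards [hM] with x hx using (abs_le.1 hx).1⟩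
  have hf := frequently_lt_of_lt_limsup hco h2
  refine hf (measure_mono_null (fun x hx => ?_) h0)
  simpa using hx

theorem hasDampingBelow_essInf (hd : 1 ≤ d) (hΩ : IsOpen Ω) (hne : Ω.Nonempty) (h : H1 Ω a b) :
    HasDampingBelow h 1 (-essInf a (volume.restrict Ω)) := by
  intro c hc n
  obtain ⟨c', h1, h2⟩ := exists_between hc
  refine exists_submodule_damping hd hΩ h 1 h1 (fun h0 => ?_) n
  obtain ⟨M, hM⟩ := exists_abs_le h
  have : NeBot (ae (volume.restrict Ω)) := by
    rw [ae_neBot, Ne, Measure.restrict_eq_zero]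
    exact (hΩ.measure_pos volume hne).ne'
  have hco : IsCoboundedUnder (· ≥ ·) (ae (volume.restrict Ω)) a :=
    IsBoundedUnder.isCoboundedUnder_ge ⟨M, by
      rw [eventually_map]
      filter_upwards [hM] with x hx using (abs_le.1 hx).2⟩
  have hf := frequently_lt_of_liminf_lt hco (show essInf a (volume.restrict Ω) < -c' by linarith)
  refine hf (measure_mono_null (fun x hx => ?_) h0)
  have : a x < -c' := by simpa using hx
  change c' < -(1 * a x)
  linarith

end Curves

end DampedWave

open DampedWave
theorem theorem2 {d : ℕ} (hd : 1 ≤ d) (Ω : Set (Space d)) (hΩ : IsOpen Ω) (hc : IsConnected Ω)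
    (a b : Space d → ℝ) (h : H1 Ω a b) (h2 : H2 Ω a) :
    -- one negative and one positive point of the spectrum, for all large `α`
    (∀ᶠ α : ℝ in atTop, (∃ r : ℝ, r < 0 ∧ (r : ℂ) ∈ spec (waveOp h α)) ∧
      ∃ r : ℝ, 0 < r ∧ (r : ℂ) ∈ spec (waveOp h α)) ∧
    -- slope condition on `γ_∞`
    ((∃ l : EReal, Tendsto (fun μ : ℝ => gammaInf h μ / (μ : EReal)) atBot (𝓝 l) ∧
        l < (essSup a (volume.restrict Ω) : ℝ)) →
      ∃ s : ℕ → ℝ, StrictMono s ∧ (∀ j, 0 < s j) ∧ Tendsto s atTop atTop ∧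
        ∀ j, 1 ≤ j → ∀ α ∈ Ico (s j) (s (j + 1)),
          (j : ℕ∞) ≤ eigenvalueCount (waveOp h α) (Iio 0)) ∧
    ((∃ l : EReal, Tendsto (fun μ : ℝ => gammaInf h μ / (μ : EReal)) atTop (𝓝 l) ∧
        (essInf a (volume.restrict Ω) : ℝ) < l) →
      ∃ s : ℕ → ℝ, StrictMono s ∧ (∀ j, 0 < s j) ∧ Tendsto s atTop atTop ∧
        ∀ j, 1 ≤ j → ∀ α ∈ Ico (s j) (s (j + 1)),
          (j : ℕ∞) ≤ eigenvalueCount (waveOp h α) (Ioi 0)) ∧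
    -- `γ_∞` positive on a half-line
    ((∀ μ : ℝ, μ ≤ 0 → 0 < gammaInf h μ) →
      ∃ s : ℕ → ℝ, StrictMono s ∧ (∀ j, 0 < s j) ∧ Tendsto s atTop atTop ∧
        (∀ j, 1 ≤ j → ∀ α ∈ Ioc (s j) (s (j + 1)),
          2 * (j : ℕ∞) + negCount h 0 ≤ eigenvalueCount (waveOp h α) (Iio 0)) ∧
        ∀ α ∈ Ioc 0 (s 1), negCount h 0 ≤ eigenvalueCount (waveOp h α) (Iio 0)) ∧
    ((∀ μ : ℝ, 0 ≤ μ → 0 < gammaInf h μ) →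
      ∃ s : ℕ → ℝ, StrictMono s ∧ (∀ j, 0 < s j) ∧ Tendsto s atTop atTop ∧
        (∀ j, 1 ≤ j → ∀ α ∈ Ioc (s j) (s (j + 1)),
          2 * (j : ℕ∞) + negCount h 0 ≤ eigenvalueCount (waveOp h α) (Ioi 0)) ∧
        ∀ α ∈ Ioc 0 (s 1), negCount h 0 ≤ eigenvalueCount (waveOp h α) (Ioi 0)) ∧
    -- `γ_∞` negative somewhere on a half-line
    ((∃ μ : ℝ, μ ≤ 0 ∧ gammaInf h μ < 0) →
      ∀ᶠ α : ℝ in atTop, ∃ r : ℝ, r < 0 ∧ (r : ℂ) ∈ essSpec (waveOp h α)) ∧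
    ((∃ μ : ℝ, 0 ≤ μ ∧ gammaInf h μ < 0) →
      ∀ᶠ α : ℝ in atTop, ∃ r : ℝ, 0 < r ∧ (r : ℂ) ∈ essSpec (waveOp h α)) ∧
    -- `γ_∞` positive at `0` and negative somewhere on a half-line
    (0 < gammaInf h 0 → (∃ μ : ℝ, μ ≤ 0 ∧ gammaInf h μ < 0) →
      ∀ᶠ α : ℝ in atTop, ∃ r r' : ℝ, r < 0 ∧ r' < 0 ∧ r ≠ r' ∧
        (r : ℂ) ∈ essSpec (waveOp h α) ∧ (r' : ℂ) ∈ essSpec (waveOp h α)) ∧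
    (0 < gammaInf h 0 → (∃ μ : ℝ, 0 ≤ μ ∧ gammaInf h μ < 0) →
      ∀ᶠ α : ℝ in atTop, ∃ r r' : ℝ, 0 < r ∧ 0 < r' ∧ r ≠ r' ∧
        (r : ℂ) ∈ essSpec (waveOp h α) ∧ (r' : ℂ) ∈ essSpec (waveOp h α)) := by

  have hm := hasDampingBelow_essSup hd hΩ hc.nonempty h
  have hp := hasDampingBelow_essInf hd hΩ hc.nonempty h
  have hm0 := h2.2
  have hp0 : 0 < -essInf a (volume.restrict Ω) := neg_pos.2 h2.1
  have sm : (-1 : ℝ) * -1 = 1 := by norm_num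
  have sp : (1 : ℝ) * 1 = 1 := one_mul 1
  have Im : {r : ℝ | 0 < -1 * r} = Iio 0 := by ext r; simp
  have Ip : {r : ℝ | 0 < 1 * r} = Ioi 0 := by ext r; simp
  have rm : ∀ {r : ℝ}, 0 < -1 * r → r < 0 := fun hr => by linarith
  have rp : ∀ {r : ℝ}, 0 < 1 * r → 0 < r := fun hr => by linarith
  have gm : ∀ μ : ℝ, gammaInf h μ = gammaInfCurve h (-1) (-μ) := fun μ => by
    rw [gammaInf_eq_gammaInfCurve hΩ h sm, neg_one_mul]
  have gp : ∀ μ : ℝ, gammaInf h μ = gammaInfCurve h 1 μ := fun μ => by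
    rw [gammaInf_eq_gammaInfCurve hΩ h sp, one_mul]
  refine ⟨?_, ?_, ?_, ?_, ?_, ?_, ?_, ?_, ?_⟩
  · filter_upwards [hm.eventually_spec hΩ hm0 sm, hp.eventually_spec hΩ hp0 sp] with α h1 h2
    obtain ⟨r, hr, hr'⟩ := h1
    obtain ⟨s, hs, hs'⟩ := h2
    exact ⟨⟨r, rm hr, hr'⟩, ⟨s, rp hs, hs'⟩⟩
  · rintro ⟨l, hl, hlm⟩
    obtain ⟨c, hcm, hslope⟩ := exists_slope_atBot hΩ hl hlm
    obtain ⟨s, h1, h2, h3, h4⟩ := hm.exists_thresholds_of_slope hΩ hm0 sm hcm hslope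
    rw [Im] at h4
    exact ⟨s, h1, h2, h3, fun j _ α hα => h4 j α hα.1⟩
  · rintro ⟨l, hl, hlm⟩
    obtain ⟨c, hcm, hslope⟩ := exists_slope_atTop (m := -essInf a (volume.restrict Ω)) hΩ hl
      (by rw [neg_neg]; exact hlm)
    obtain ⟨s, h1, h2, h3, h4⟩ := hp.exists_thresholds_of_slope hΩ hp0 sp hcm hslope
    rw [Ip] at h4
    exact ⟨s, h1, h2, h3, fun j _ α hα => h4 j α hα.1⟩
  · intro hpos
    obtain ⟨h0, s, h1, h2, h3, h4⟩ := hm.exists_thresholds_of_pos hΩ hm0 sm fun τ hτ => by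
      have := hpos (-τ) (by linarith)
      rwa [gm, neg_neg] at this
    rw [Im] at h0 h4
    exact ⟨s, h1, h2, h3, fun j _ α hα => h4 j α hα.1.le, fun α hα => h0 α hα.1⟩
  · intro hpos
    obtain ⟨h0, s, h1, h2, h3, h4⟩ := hp.exists_thresholds_of_pos hΩ hp0 sp fun τ hτ => by
      have := hpos τ hτ
      rwa [gp] at this
    rw [Ip] at h0 h4
    exact ⟨s, h1, h2, h3, fun j _ α hα => h4 j α hα.1.le, fun α hα => h0 α hα.1⟩
  · rintro ⟨μ, hμ, hneg⟩
    rw [gm] at hneg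
    filter_upwards [eventually_essSpec hΩ sm (neg_nonneg.2 hμ) hneg] with α ⟨r, hr, hr'⟩
    exact ⟨r, rm hr, hr'⟩
  · rintro ⟨μ, hμ, hneg⟩
    rw [gp] at hneg
    filter_upwards [eventually_essSpec hΩ sp hμ hneg] with α ⟨r, hr, hr'⟩
    exact ⟨r, rp hr, hr'⟩
  · rintro hpos ⟨μ, hμ, hneg⟩
    rw [gm] at hneg hpos
    rw [neg_zero] at hpos
    filter_upwards [eventually_essSpec_two hΩ sm (neg_nonneg.2 hμ) hpos hneg] with
      α ⟨r, r', hr, hr', hrest⟩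
    exact ⟨r, r', rm hr, rm hr', hrest⟩
  · rintro hpos ⟨μ, hμ, hneg⟩
    rw [gp] at hneg hpos
    filter_upwards [eventually_essSpec_two hΩ sp hμ hpos hneg] with α ⟨r, r', hr, hr', hrest⟩
    exact ⟨r, r', rp hr, rp hr', hrest⟩
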